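/- Let $R$ be an associative ring with unit. All modules are left $R$-modules unless stated otherwise, and an $R^{op}$-module is a right $R$-module. A module is called a PGF-module (projectively coresolved Gorenstein flat module) if it is a syzygy of an acyclic complex $P_*$ of projective modules such that the complex of abelian groups $I\otimes_R P_*$ is acyclic for every injective right module $I$. Let $\mathrm{PGF}(R)$ be the class of PGF-modules and let $\mathrm{PGF}(R)^{\perp}$ be the class of those modules $Q$ for which $\mathrm{Ext}^1_R(G,Q)=0$ for all $G\in\mathrm{PGF}(R)$. The PGF-dimension $\mathrm{PGF\text{-}dim}_R M$ of a module $M$ is the least $n\ge 0$ for which there is an exact sequence $0\to G_n\to\cdots\to G_0\to M\to 0$ with all $G_i\in\mathrm{PGF}(R)$, and $\infty$ if there is no such $n$. Likewise $\mathrm{pd}_R K$ denotes the projective dimension, i.e. the least length of a projective resolution of $K$ (so the zero module has projective dimension $0$). **Theorem 3.4.** The following conditions are equivalent for a module $M$ and a non-negative integer $n$: (i) $\mathrm{PGF\text{-}dim}_R M=n$. (ii) There exists a short exact sequence $0\to K\to G\to M\to 0$, where $G$ is a PGF-module and $\mathrm{pd}_R K=n-1$. If $n=0$, the latter is understood to mean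 $K=0$. If $n=1$, it is also required that the exact sequence be non-split. (iii) There exists a short exact sequence $0\to M\to K\to G\to 0$, where $G$ is a PGF-module and $\mathrm{pd}_R K=n$. (iv) There exist a projective module $P$ and a short exact sequence $0\to G\to M\oplus P\to K\to 0$, which remains exact after applying the functor $\mathrm{Hom}_R(-,Q)$ for any module $Q\in\mathrm{PGF}(R)^{\perp}$, where $G$ is a PGF-module and $\mathrm{pd}_R K=n$. (v) There exist a PGF-module $P$ and a short exact sequence $0\to G\to M\oplus P\to K\to 0$, where $G$ is a PGF-module and $\mathrm{pd}_R K=n$. If $n=1$, it is also required that the exact sequence remain exact after applying the functor $\mathrm{Hom}_R(-,Q)$ for any projective module $Q$. -/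

import Mathlib

open CategoryTheory CategoryTheory.Limits
open scoped TensorProduct

universe u

namespace PGF

section Tensor

variable {R : Type u} [Ring R]

/-- The subgroup of `I ⊗ P` (tensor product over the integers) generated by all the elements
`x r ⊗ p - x ⊗ r p`, where `I` is a right and `P` a left `R`-module. A right `R`-module is a
module over the opposite ring. -/
def balancedRel (I : ModuleCat.{u} Rᵐᵒᵖ) (P : ModuleCat.{u} R) : Submodule ℤ (I ⊗[ℤ] P) :=
  Submodule.span ℤ
    {t | ∃ (x : I) (r : R) (p : P), t = (MulOpposite.op r • x) ⊗ₜ[ℤ] p - x ⊗ₜ[ℤ] (r • p)}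

/-- The abelian group `I ⊗_R P`, for a right module `I` and a left module `P` over a ring `R`
that is not assumed to be commutative. -/
abbrev Tensor (I : ModuleCat.{u} Rᵐᵒᵖ) (P : ModuleCat.{u} R) : Type u :=
  (I ⊗[ℤ] P) ⧸ balancedRel I P

/-- The additive map `I ⊗_R P ⟶ I ⊗_R Q` induced by an `R`-linear map `f : P ⟶ Q`;
it sends `x ⊗ p` to `x ⊗ f p`. -/
def Tensor.map (I : ModuleCat.{u} Rᵐᵒᵖ) {P Q : ModuleCat.{u} R} (f : P ⟶ Q) :
    Tensor I P →ₗ[ℤ] Tensor I Q :=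
  Submodule.mapQ (balancedRel I P) (balancedRel I Q)
    (LinearMap.lTensor I f.hom.toAddMonoidHom.toIntLinearMap) (by
      refine Submodule.span_le.2 ?_
      rintro _ ⟨x, r, p, rfl⟩
      refine Submodule.subset_span ⟨x, r, f.hom p, ?_⟩
      change LinearMap.lTensor I _ (_ - _) = _
      rw [map_sub, LinearMap.lTensor_tmul, LinearMap.lTensor_tmul]
      change _ ⊗ₜ[ℤ] f.hom p - x ⊗ₜ[ℤ] f.hom (r • p) = _
      rw [map_smul])

end Tensor

variable {R : Type u} [Ring R]

/-- Projectively coresolved Gorenstein flat modules: the syzygies of those acyclic complexes `C`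
of projective modules (indexed by all integers) for which the complex of abelian groups
`I ⊗_R C` is acyclic for every injective right module `I`. -/
def IsPGF (M : ModuleCat.{u} R) : Prop :=
  ∃ C : CochainComplex (ModuleCat.{u} R) ℤ,
    (∀ i, Projective (C.X i)) ∧
    C.Acyclic ∧
    (∀ I : ModuleCat.{u} Rᵐᵒᵖ, Injective I → ∀ i : ℤ,
      Function.Exact (Tensor.map I (C.d (i - 1) i)) (Tensor.map I (C.d i (i + 1)))) ∧
    ∃ i, Nonempty (M ≅ C.cycles i)

/-- `HasResolution n M`: there is an exact sequence `0 ⟶ Gₙ ⟶ ⋯ ⟶ G₀ ⟶ M ⟶ 0` with all the `Gᵢ`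
PGF-modules. A sequence of length `n + 1` is given by its last part `0 ⟶ L ⟶ G₀ ⟶ M ⟶ 0` and a
sequence of length `n` for the kernel `L`. -/
def HasResolution : ℕ → ModuleCat.{u} R → Prop
  | 0, M => ∃ G : ModuleCat.{u} R, IsPGF G ∧ Nonempty (G ≅ M)
  | n + 1, M => ∃ (L G : ModuleCat.{u} R) (f : L ⟶ G) (g : G ⟶ M) (w : f ≫ g = 0),
      (ShortComplex.mk f g w).ShortExact ∧ IsPGF G ∧ HasResolution n L

/-- The PGF-dimension: the least length of a PGF-resolution, `⊤` if there is none. -/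
noncomputable def dim (M : ModuleCat.{u} R) : ℕ∞ :=
  ⨅ (n : ℕ) (_ : HasResolution n M), (n : ℕ∞)

/-- The projective dimension as the least length of a projective resolution. It differs from
`CategoryTheory.projectiveDimension` in that the zero module gets the value `0` instead
of `⊥`. -/
noncomputable def pd (M : ModuleCat.{u} R) : ℕ∞ :=
  (projectiveDimension M).unbotD 0

/-- The right orthogonal class of the class of PGF-modules with respect to `Ext¹`. -/
def InRightOrthogonal (Q : ModuleCat.{u} R) : Prop :=
  ∀ G : ModuleCat.{u} R, IsPGF G → Subsingleton (Abelian.Ext G Q 1)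

/-- The sequence `0 ⟶ Hom(Z, Q) ⟶ Hom(Y, Q) ⟶ Hom(X, Q) ⟶ 0` induced by `f : X ⟶ Y` and
`g : Y ⟶ Z` is exact. -/
def HomExact {X Y Z : ModuleCat.{u} R} (f : X ⟶ Y) (g : Y ⟶ Z) (Q : ModuleCat.{u} R) : Prop :=
  Function.Injective (fun h : Z ⟶ Q => g ≫ h) ∧
  Function.Exact (fun h : Z ⟶ Q => g ≫ h) (fun h : Y ⟶ Q => f ≫ h) ∧
  Function.Surjective (fun h : Y ⟶ Q => f ≫ h)

end PGF

/-! The decisive fact is that `Ext` from a PGF-module to a projective module vanishes in all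
positive degrees, although the definition only speaks of tensoring with injective right modules. A
complex of projectives that stays exact after these tensor products satisfies a uniform finitary
form of `Hom`-exactness into any projective `N` (`locallyExact_of_tensor_exact`). This form survives
passage to reduced powers and to pure quotients, and it extends a cocycle `g` after `N` is embedded
into a reduced power. Iterating yields a pure exact complex `0 → N → C₀ → C₁ → ⋯` and a chain map
into it from the projective complex that begins with `g`. Such a map is null-homotopic
(`exists_homotopy`), and the lowest component of the homotopy extends `g` to `N` itself
(`exists_extension_of_locallyExact`).

For character modules of injective right modules, the corresponding `Ext` vanishing is Hom-tensor
duality. Vanishing against both kinds of modules, together with embeddings into projectives whose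
cokernels stay in the class, characterizes PGF-modules (`isCoresolvedClass_isPGF`,
`IsCoresolvedClass.isPGF`). Hence they are closed under extensions and kernels of epimorphisms.

The rest is relative homological algebra. A module with a PGF-resolution of length `n` embeds into a
module of projective dimension at most `n` with PGF cokernel (`HasResolution.exists_embedding`).
PGF-modules have no `Ext` into modules of finite projective dimension, so for a module that already
has finite projective dimension this embedding splits, and a PGF-resolution of length `n` bounds the
projective dimension by `n` (`HasResolution.hasProjectiveDimensionLE`). This comparison turns a
PGF-resolution that is too short into a contradiction with the prescribed `pd K`; the extra
conditions for `n = 1` exclude the one case in which `M` is PGF but `K` has dimension shifted by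
one. -/

namespace PGF

/-! ### Local exactness, reduced powers and purity -/

section LocalExactness

variable {R : Type u} [Ring R]
variable {P' P P'' N L C : Type u} [AddCommGroup P'] [AddCommGroup P] [AddCommGroup P'']
  [AddCommGroup N] [AddCommGroup L] [AddCommGroup C]
  [Module R P'] [Module R P] [Module R P''] [Module R N] [Module R L] [Module R C]

/-- A uniform local form of the exactness of `Hom(P'', N) ⟶ Hom(P, N) ⟶ Hom(P', N)`. -/
def LocallyExact (a : P' →ₗ[R] P) (b : P →ₗ[R] P'') (N : Type u) [AddCommGroup N]
    [Module R N] : Prop :=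
  ∀ S : Finset P, ∃ T : Finset P', ∀ g : P →ₗ[R] N, (∀ t ∈ T, g (a t) = 0) →
    ∃ h : P'' →ₗ[R] N, ∀ s ∈ S, g s = h (b s)

/-- Purity of (the image of) a linear map, in terms of finite sets of equations: a map from a
projective module that sends a finite set into the image of `i` can be replaced by a map
into the image without changing its values on that set. -/
def IsPureMap (i : L →ₗ[R] C) : Prop :=
  ∀ (Q : Type u) [AddCommGroup Q] [Module R Q] [Module.Projective R Q] (A : Finset Q)
    (g : Q →ₗ[R] C), (∀ x ∈ A, g x ∈ LinearMap.range i) →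
    ∃ g' : Q →ₗ[R] L, ∀ x ∈ A, i (g' x) = g x

/-- Finitely many elements of a projective module have finite coordinates. -/
theorem exists_finite_coordinates [Module.Projective R P] (S : Finset P) :
    ∃ (U : Finset P) (φ : P → P →ₗ[R] R), ∀ s ∈ S, ∑ u ∈ U, φ u s • u = s := by
  classical
  obtain ⟨σ, hσ⟩ := (Module.projective_def' (R := R) (P := P)).1 inferInstance
  refine ⟨S.biUnion fun s => (σ s).support, fun u => Finsupp.lapply u ∘ₗ σ, fun s hs => ?_⟩
  have h1 : Finsupp.linearCombination R id (σ s) = s := LinearMap.congr_fun hσ s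
  conv_rhs => rw [← h1]
  rw [Finsupp.linearCombination_apply, Finsupp.sum_of_support_subset _
    (Finset.subset_biUnion_of_mem (fun s => (σ s).support) hs) _ (by simp)]
  simp

/-- A lift of `g` to `C` sends the finite set `a T` into the submodule `N`. Purity supplies a map
into `N` with the same values there, and subtracting it makes the lift vanish on `a T` without
changing its class modulo `N`. -/
theorem LocallyExact.of_pure_quotient [Module.Projective R P] {a : P' →ₗ[R] P}
    {b : P →ₗ[R] P''} (hC : LocallyExact a b C) {i : N →ₗ[R] C} (hi : IsPureMap i)
    {p : C →ₗ[R] L} (hp : Function.Surjective p) (hip : Function.Exact i p) :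
    LocallyExact a b L := by
  classical
  intro S
  obtain ⟨T, hT⟩ := hC S
  refine ⟨T, fun g hg => ?_⟩
  obtain ⟨g₀, hg₀⟩ := Module.projective_lifting_property p g hp
  have hg₀' : ∀ x, p (g₀ x) = g x := fun x => LinearMap.congr_fun hg₀ x
  obtain ⟨g₁, hg₁⟩ := hi P (T.image a) g₀ (by
    intro x hx
    obtain ⟨t, ht, rfl⟩ := Finset.mem_image.1 hx
    exact (hip _).1 (by rw [hg₀', hg t ht]))
  obtain ⟨h, hh⟩ := hT (g₀ - i ∘ₗ g₁) (fun t ht => by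
    simp [hg₁ (a t) (Finset.mem_image_of_mem a ht)])
  refine ⟨p ∘ₗ h, fun s hs => ?_⟩
  rw [LinearMap.comp_apply, ← hh s hs]
  simp [hg₀', hip.apply_apply_eq_zero]

section Germ

variable {Λ : Type u} (l : Filter Λ)

/-- The canonical map from a module to its reduced power. -/
def germConst (N : Type u) [AddCommGroup N] [Module R N] : N →ₗ[R] Filter.Germ l N where
  toFun n := ((fun _ => n : Λ → N) : Filter.Germ l N)
  map_add' _ _ := rfl
  map_smul' _ _ := rfl

/-- The map into a reduced power given by a family of maps. -/
def germPi (h : Λ → P →ₗ[R] N) : P →ₗ[R] Filter.Germ l N where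
  toFun x := ((fun k => h k x : Λ → N) : Filter.Germ l N)
  map_add' x y := by
    simp only [map_add]; rfl
  map_smul' r x := by
    simp only [map_smul]; rfl

/-- A map from a projective module to a reduced power is given by a family of maps, as far as
finitely many elements are concerned. -/
theorem exists_germ_family [Module.Projective R P] (S : Finset P)
    (g : P →ₗ[R] Filter.Germ l N) :
    ∃ h : Λ → P →ₗ[R] N, ∀ s ∈ S, g s = germPi l h s := by
  obtain ⟨U, φ, hφ⟩ := exists_finite_coordinates (R := R) S
  have hrep : ∀ u : P, ∃ n : Λ → N, (n : Filter.Germ l N) = g u := fun u =>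
    Quotient.exists_rep (g u)
  choose n hn using hrep
  let h : Λ → P →ₗ[R] N := fun k => ∑ u ∈ U, (φ u).smulRight (n u k)
  have key : ∀ (V : Finset P) (s : P), ((fun k => ∑ u ∈ V, φ u s • n u k : Λ → N) :
      Filter.Germ l N) = ∑ u ∈ V, φ u s • g u := by
    classical
    intro V s
    induction V using Finset.induction_on with
    | empty => simp only [Finset.sum_empty]; rfl
    | insert v V hv ih =>
      simp only [Finset.sum_insert hv]
      rw [← ih, ← hn v]; rfl
  refine ⟨h, fun s hs => ?_⟩
  conv_lhs => rw [← hφ s hs]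
  rw [map_sum]
  simp only [map_smul]
  rw [← key U s]
  simp [germPi, h]

/-- Finitely many equations that hold eventually along a proper filter hold at one common index, and
the component at that index is the required map into `N`. -/
theorem isPureMap_germConst [l.NeBot] : IsPureMap (germConst (R := R) l N) := by
  intro Q _ _ _ A g hg
  obtain ⟨h, hh⟩ := exists_germ_family l A g
  choose! n hn using fun x hx => LinearMap.mem_range.1 (hg x hx)
  have : ∀ᶠ k in l, ∀ x ∈ A, h k x = n x := by
    rw [Filter.eventually_all_finset]
    intro x hx
    have := (hn x hx).trans (hh x hx)
    exact (Filter.Germ.coe_eq.1 this).symm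
  obtain ⟨k, hk⟩ := this.exists
  exact ⟨h k, fun x hx => by rw [hk x hx, hn x hx]⟩

theorem germConst_injective [l.NeBot] : Function.Injective (germConst (R := R) l N) := by
  intro x y h
  obtain ⟨k, hk⟩ := (Filter.Germ.coe_eq.1 h).exists
  exact hk

/-- Here the uniformity of `T` in `g` matters: the same `T` serves all components of a family
representing `g`, so the extensions can be chosen componentwise. -/
theorem LocallyExact.germ [Module.Projective R P] {a : P' →ₗ[R] P} {b : P →ₗ[R] P''}
    (hN : LocallyExact a b N) : LocallyExact a b (Filter.Germ l N) := by
  classical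
  intro S
  obtain ⟨T, hT⟩ := hN S
  refine ⟨T, fun g hg => ?_⟩
  obtain ⟨f, hf⟩ := exists_germ_family l (S ∪ T.image a) g
  have ev : ∀ᶠ k in l, ∀ t ∈ T, f k (a t) = 0 := by
    rw [Filter.eventually_all_finset]
    intro t ht
    have := hf (a t) (Finset.mem_union_right _ (Finset.mem_image_of_mem a ht))
    rw [hg t ht] at this
    exact (Filter.Germ.coe_eq.1 this).symm
  have : ∀ k, ∃ h : P'' →ₗ[R] N, (∀ t ∈ T, f k (a t) = 0) → ∀ s ∈ S, f k s = h (b s) := by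
    intro k
    by_cases hk : ∀ t ∈ T, f k (a t) = 0
    · obtain ⟨h, hh⟩ := hT (f k) hk
      exact ⟨h, fun _ => hh⟩
    · exact ⟨0, fun h => absurd h hk⟩
  choose h hh using this
  refine ⟨germPi l h, fun s hs => ?_⟩
  rw [hf s (Finset.mem_union_left _ hs)]
  exact Filter.Germ.coe_eq.2 (ev.mono fun k hk => hh k hk s hs)

end Germ

/-- Local exactness gives an extension into a reduced power. -/
theorem LocallyExact.exists_germ_extension {a : P' →ₗ[R] P} {b : P →ₗ[R] P''}
    (hN : LocallyExact a b N) (g : P →ₗ[R] N) (hg : g ∘ₗ a = 0) :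
    ∃ h : P'' →ₗ[R] Filter.Germ (Filter.atTop : Filter (Finset P)) N,
      h ∘ₗ b = germConst _ N ∘ₗ g := by
  classical
  have : ∀ S : Finset P, ∃ h : P'' →ₗ[R] N, ∀ s ∈ S, g s = h (b s) := fun S => by
    obtain ⟨T, hT⟩ := hN S
    exact hT g fun t _ => LinearMap.congr_fun hg t
  choose h hh using this
  refine ⟨germPi _ h, LinearMap.ext fun x => Filter.Germ.coe_eq.2 ?_⟩
  -- The index `S` eventually contains any given `x`, and from then on the component `h S` has the
  -- right value at `b x`.
  filter_upwards [Filter.eventually_ge_atTop {x}] with S hS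
  exact (hh S x (hS (Finset.mem_singleton_self x))).symm

end LocalExactness

/-! ### Null-homotopies on degreewise finite subcomplexes -/

section NullHomotopy

variable {R : Type u} [Ring R]

theorem eq_of_eq_on_basis {B N : Type u} [AddCommGroup N] [Module R N] {F G : (B →₀ R) →ₗ[R] N}
    {S : Set B} (h : ∀ b ∈ S, F (Finsupp.single b 1) = G (Finsupp.single b 1))
    {x : B →₀ R} (hx : (x.support : Set B) ⊆ S) : F x = G x := by
  rw [← Finsupp.sum_single x, Finsupp.sum, map_sum, map_sum]
  refine Finset.sum_congr rfl fun b hb => ?_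
  rw [← mul_one (x b), ← smul_eq_mul, ← Finsupp.smul_single, map_smul, map_smul, h b (hx hb)]

/-- A linear map with given values on a set of basis vectors, vanishing on the others. -/
theorem exists_linearMap_on_basis {B N : Type u} [AddCommGroup N] [Module R N] (S : Set B)
    (p : B → N → Prop) (h : ∀ b ∈ S, ∃ n, p b n) :
    ∃ F : (B →₀ R) →ₗ[R] N, ∀ b ∈ S, p b (F (Finsupp.single b 1)) := by
  choose! n hn using h
  exact ⟨Finsupp.linearCombination R n, fun b hb => by simpa using hn b hb⟩

variable {B E : ℕ → Type u} [∀ k, AddCommGroup (E k)] [∀ k, Module R (E k)]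
  (δ : ∀ k, (B k →₀ R) →ₗ[R] (B (k + 1) →₀ R)) (ε : ∀ k, E k →ₗ[R] E (k + 1))
  (f : ∀ k, (B k →₀ R) →ₗ[R] E k)

/-- `s` is a null-homotopy of `f` on the basis vectors in the sets `S k`. -/
def IsHomotopyOn (S : ∀ k, Set (B k)) (s : ∀ k, (B (k + 1) →₀ R) →ₗ[R] E k) : Prop :=
  (∀ b ∈ S 0, f 0 (Finsupp.single b 1) = s 0 (δ 0 (Finsupp.single b 1))) ∧
  ∀ k, ∀ b ∈ S (k + 1), f (k + 1) (Finsupp.single b 1) =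
    ε k (s k (Finsupp.single b 1)) + s (k + 1) (δ (k + 1) (Finsupp.single b 1))

/-- The sets `S k` of basis vectors span a subcomplex. -/
def IsClosedUnder (S : ∀ k, Set (B k)) : Prop :=
  ∀ k, ∀ b ∈ S k, ((δ k (Finsupp.single b 1)).support : Set (B (k + 1))) ⊆ S (k + 1)

variable {δ ε f}

theorem exists_pure_lift (hp : ∀ k, IsPureMap (LinearMap.ker (ε k)).subtype) {k : ℕ}
    {D : Type u} (A : Finset (D →₀ R)) (g : (D →₀ R) →ₗ[R] E k) (hg : ∀ x ∈ A, ε k (g x) = 0) :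
    ∃ g' : (D →₀ R) →ₗ[R] E k, (∀ x, ε k (g' x) = 0) ∧ ∀ x ∈ A, g' x = g x := by
  obtain ⟨g', h⟩ := hp k (D →₀ R) A g (fun x hx => by simpa using hg x hx)
  exact ⟨(LinearMap.ker (ε k)).subtype ∘ₗ g', fun x => (g' x).2, h⟩

/-- Purity first replaces `g` by a map landing in cycles everywhere. By exactness these are
boundaries, and a map from a free module to boundaries lifts basis vector by basis vector. -/
theorem exists_boundary_lift (hex : ∀ k, Function.Exact (ε k) (ε (k + 1)))
    (hp : ∀ k, IsPureMap (LinearMap.ker (ε k)).subtype) {k : ℕ}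
    {D : Type u} (A : Finset (D →₀ R)) (g : (D →₀ R) →ₗ[R] E (k + 1))
    (hg : ∀ x ∈ A, ε (k + 1) (g x) = 0) :
    ∃ t : (D →₀ R) →ₗ[R] E k, ∀ x ∈ A, ε k (t x) = g x := by
  obtain ⟨g', h0, h1⟩ := exists_pure_lift hp A g hg
  obtain ⟨t, ht⟩ := exists_linearMap_on_basis (R := R) (Set.univ : Set D)
    (fun b n => ε k n = g' (Finsupp.single b 1)) (fun b _ => (hex k _).1 (h0 _))
  refine ⟨t, fun x hx => ?_⟩
  rw [← h1 x hx]
  exact eq_of_eq_on_basis (F := ε k ∘ₗ t) (G := g') ht (Set.subset_univ _)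

/-- The inductive step in the construction of a null-homotopy on a subcomplex that is finitely
generated in every degree. -/
theorem exists_homotopy_step (hδ : ∀ k, δ (k + 1) ∘ₗ δ k = 0)
    (hε : ∀ k, Function.Exact (ε k) (ε (k + 1)))
    (hp : ∀ k, IsPureMap (LinearMap.ker (ε k)).subtype)
    (hf : ∀ k, ε k ∘ₗ f k = f (k + 1) ∘ₗ δ k) (k : ℕ)
    (T : Finset (B k)) (T' : Finset (B (k + 1)))
    (hT : ∀ b ∈ T, ((δ k (Finsupp.single b 1)).support : Set (B (k + 1))) ⊆ T')
    (r : (B k →₀ R) →ₗ[R] E k) (hr : ε k ∘ₗ r = ε k ∘ₗ f k)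
    (t : (B (k + 1) →₀ R) →ₗ[R] E k)
    (ht : ∀ b ∈ T, t (δ k (Finsupp.single b 1)) = r (Finsupp.single b 1)) :
    ∃ (s : (B (k + 1) →₀ R) →ₗ[R] E k) (t' : (B (k + 2) →₀ R) →ₗ[R] E (k + 1)),
      (∀ b ∈ T, s (δ k (Finsupp.single b 1)) = r (Finsupp.single b 1)) ∧
      ∀ b ∈ T', t' (δ (k + 1) (Finsupp.single b 1)) =
        f (k + 1) (Finsupp.single b 1) - ε k (s (Finsupp.single b 1)) := by
  classical
  have hδ' : ∀ k x, δ (k + 1) (δ k x) = 0 := fun k x => LinearMap.congr_fun (hδ k) x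
  have hf' : ∀ k x, ε k (f k x) = f (k + 1) (δ k x) := fun k x => LinearMap.congr_fun (hf k) x
  have hε' : ∀ k x, ε (k + 1) (ε k x) = 0 := fun k x => (hε k).apply_apply_eq_zero x
  -- This `t'` is prepared for the next degree: it will witness that the remainder left by `s`
  -- factors through the differential on `T'`.
  obtain ⟨t', ht'⟩ := exists_boundary_lift hε hp
    (T'.image fun b => δ (k + 1) (Finsupp.single b 1)) (f (k + 2)) (by
      intro x hx
      obtain ⟨b, -, rfl⟩ := Finset.mem_image.1 hx
      rw [hf', hδ', map_zero])
  have ht'' : ∀ b ∈ T', ε (k + 1) (t' (δ (k + 1) (Finsupp.single b 1))) =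
      f (k + 2) (δ (k + 1) (Finsupp.single b 1)) := fun b hb =>
    ht' _ (Finset.mem_image_of_mem _ hb)
  -- Adding `z₀` to `t` gives the required remainder in the next degree, but may destroy the
  -- equation on the boundaries of `T`.
  obtain ⟨z₀, hz₀⟩ := exists_linearMap_on_basis (R := R) (T' : Set (B (k + 1)))
    (fun b n => ε k n = f (k + 1) (Finsupp.single b 1) - ε k (t (Finsupp.single b 1)) -
      t' (δ (k + 1) (Finsupp.single b 1))) (fun b hb => (hε k _).1 (by
        rw [map_sub, map_sub, hε', hf', ht'' b hb]; simp))
  have hz₀' : ∀ b ∈ T, ε k (z₀ (δ k (Finsupp.single b 1))) = 0 := by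
    intro b hb
    have := eq_of_eq_on_basis (F := ε k ∘ₗ z₀)
      (G := f (k + 1) - ε k ∘ₗ t - t' ∘ₗ δ (k + 1)) hz₀ (hT b hb)
    have h2 := LinearMap.congr_fun hr (Finsupp.single b 1)
    simp only [LinearMap.comp_apply, LinearMap.sub_apply] at this h2
    rw [this, ht b hb, hδ', map_zero, h2, hf']
    simp
  -- On these boundaries `z₀` takes values in cycles, so purity gives a cycle-valued `z₁` that
  -- agrees with it there. Subtracting `z₁` repairs the equation on `T` and is invisible to `ε k`.
  obtain ⟨z₁, hz₁, hz₁'⟩ := exists_pure_lift hp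
    (T.image fun b => δ k (Finsupp.single b 1)) z₀ (by
      intro x hx
      obtain ⟨b, hb, rfl⟩ := Finset.mem_image.1 hx
      exact hz₀' b hb)
  refine ⟨t + (z₀ - z₁), t', fun b hb => ?_, fun b hb => ?_⟩
  · simp [ht b hb, hz₁' _ (Finset.mem_image_of_mem _ hb)]
  · simp only [LinearMap.add_apply, LinearMap.sub_apply, map_add, map_sub, hz₁, hz₀ b hb]
    abel

/-- Null-homotopies exist on subcomplexes that are finitely generated in every degree. -/
theorem exists_homotopy_on_finite (hδ : ∀ k, δ (k + 1) ∘ₗ δ k = 0)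
    (hε : ∀ k, Function.Exact (ε k) (ε (k + 1))) (hε0 : Function.Injective (ε 0))
    (hp : ∀ k, IsPureMap (LinearMap.ker (ε k)).subtype)
    (hf : ∀ k, ε k ∘ₗ f k = f (k + 1) ∘ₗ δ k)
    (T : ∀ k, Finset (B k)) (hT : IsClosedUnder δ (fun k => (T k : Set (B k)))) :
    ∃ s, IsHomotopyOn δ ε f (fun k => (T k : Set (B k))) s := by
  classical
  have hδ' : ∀ k x, δ (k + 1) (δ k x) = 0 := fun k x => LinearMap.congr_fun (hδ k) x
  have hf' : ∀ k x, ε k (f k x) = f (k + 1) (δ k x) := fun k x => LinearMap.congr_fun (hf k) x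
  have hε' : ∀ k x, ε (k + 1) (ε k x) = 0 := fun k x => (hε k).apply_apply_eq_zero x
  -- The state in degree `k` is the remainder of `f k` after subtracting `ε` of the homotopy already
  -- built, with a proof that it factors through `δ k` on `T k`.
  let St : ℕ → Type u := fun k => {r : (B k →₀ R) →ₗ[R] E k // ε k ∘ₗ r = ε k ∘ₗ f k ∧
    ∃ t : (B (k + 1) →₀ R) →ₗ[R] E k,
      ∀ b ∈ T k, t (δ k (Finsupp.single b 1)) = r (Finsupp.single b 1)}
  have step : ∀ k (r : St k), ∃ s : (B (k + 1) →₀ R) →ₗ[R] E k, ∃ r' : St (k + 1),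
      (∀ b ∈ T k, s (δ k (Finsupp.single b 1)) = r.1 (Finsupp.single b 1)) ∧
      r'.1 = f (k + 1) - ε k ∘ₗ s := by
    rintro k ⟨r, hr, t, ht⟩
    obtain ⟨s, t', hs, ht'⟩ := exists_homotopy_step hδ hε hp hf k (T k) (T (k + 1))
      (hT k) r hr t ht
    refine ⟨s, ⟨f (k + 1) - ε k ∘ₗ s, ?_, t', ht'⟩, hs, rfl⟩
    ext x; simp [hε']
  choose s nxt hs hnxt using step
  have h0 : ∃ t : (B 1 →₀ R) →ₗ[R] E 0,
      ∀ b ∈ T 0, t (δ 0 (Finsupp.single b 1)) = f 0 (Finsupp.single b 1) := by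
    obtain ⟨t, ht⟩ := exists_boundary_lift hε hp
      ((T 0).image fun b => δ 0 (Finsupp.single b 1)) (f 1) (by
        intro x hx
        obtain ⟨b, -, rfl⟩ := Finset.mem_image.1 hx
        rw [hf', hδ', map_zero])
    refine ⟨t, fun b hb => hε0 ?_⟩
    rw [ht _ (Finset.mem_image_of_mem _ hb), hf']
  let r : ∀ k, St k := fun k => Nat.rec ⟨f 0, rfl, h0⟩ nxt k
  refine ⟨fun k => s k (r k), fun b hb => (hs 0 (r 0) b hb).symm, fun k b hb => ?_⟩
  have h1 := hs (k + 1) (r (k + 1)) b hb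
  have h2 : (r (k + 1)).1 = f (k + 1) - ε k ∘ₗ s k (r k) := hnxt k (r k)
  rw [h1, h2]
  simp

/-- Every family of finite sets of basis vectors lies in a finite closed one. -/
theorem exists_finite_closure (U : ∀ k, Finset (B k)) :
    ∃ T : ∀ k, Finset (B k), (∀ k, U k ⊆ T k) ∧ IsClosedUnder δ (fun k => (T k : Set (B k))) := by
  classical
  -- The differential raises the degree, so degree `k + 1` only receives the finite supports coming
  -- from degree `k`; each `T k` remains finite although there are infinitely many degrees.
  let T : ∀ k, Finset (B k) := fun k => Nat.rec (U 0)
    (fun k T => U (k + 1) ∪ T.biUnion fun b => (δ k (Finsupp.single b 1)).support) k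
  have hT : ∀ k, T (k + 1) =
      U (k + 1) ∪ (T k).biUnion fun b => (δ k (Finsupp.single b 1)).support := fun _ => rfl
  refine ⟨T, fun k => ?_, fun k b hb => ?_⟩
  · cases k with
    | zero => exact subset_rfl
    | succ k => rw [hT]; exact Finset.subset_union_left
  · change _ ⊆ ((T (k + 1) : Finset (B (k + 1))) : Set (B (k + 1)))
    rw [hT]
    exact Finset.coe_subset.2
      ((Finset.subset_biUnion_of_mem (fun b => (δ k (Finsupp.single b 1)).support) hb).trans
        Finset.subset_union_right)

end NullHomotopy

/-! ### Extending null-homotopies by Zorn's lemma -/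

section NullHomotopy

variable {R : Type u} [Ring R]
variable {B E : ℕ → Type u} [∀ k, AddCommGroup (E k)] [∀ k, Module R (E k)]
  {δ : ∀ k, (B k →₀ R) →ₗ[R] (B (k + 1) →₀ R)} {ε : ∀ k, E k →ₗ[R] E (k + 1)}
  {f : ∀ k, (B k →₀ R) →ₗ[R] E k}

/-- The projection that kills the basis vectors in `S`. -/
noncomputable def killBasis {D : Type u} (R : Type u) [Ring R] (S : Set D) :
    (D →₀ R) →ₗ[R] (D →₀ R) := by
  classical
  exact Finsupp.linearCombination R fun b => if b ∈ S then 0 else Finsupp.single b 1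

theorem killBasis_of_mem {D : Type u} {S : Set D} {b : D} (hb : b ∈ S) :
    killBasis R S (Finsupp.single b 1) = 0 := by
  simp [killBasis, hb]

theorem killBasis_of_notMem {D : Type u} {S : Set D} {b : D} (hb : b ∉ S) :
    killBasis R S (Finsupp.single b 1) = Finsupp.single b 1 := by
  simp [killBasis, hb]

theorem killBasis_eq_zero {D : Type u} {S : Set D} {x : D →₀ R}
    (hx : (x.support : Set D) ⊆ S) : killBasis R S x = 0 :=
  eq_of_eq_on_basis (G := (0 : (D →₀ R) →ₗ[R] (D →₀ R)))
    (fun b hb => by rw [killBasis_of_mem hb]; rfl) hx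

theorem killBasis_apply {D : Type u} (S : Set D) (x : D →₀ R) (b : D) :
    (b ∈ S → killBasis R S x b = 0) ∧ (b ∉ S → killBasis R S x b = x b) := by
  classical
  refine ⟨fun hb => ?_, fun hb => ?_⟩
  · refine LinearMap.congr_fun (f := Finsupp.lapply b ∘ₗ killBasis R S) (g := 0) ?_ x
    ext c
    by_cases hc : c ∈ S
    · simp [killBasis_of_mem hc]
    · have : c ≠ b := fun h => hc (h ▸ hb)
      simp [killBasis_of_notMem hc, this]
  · refine LinearMap.congr_fun (f := Finsupp.lapply b ∘ₗ killBasis R S)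
      (g := Finsupp.lapply b) ?_ x
    ext c
    by_cases hc : c ∈ S
    · have : c ≠ b := fun h => hb (h ▸ hc)
      simp [killBasis_of_mem hc, this]
    · simp [killBasis_of_notMem hc]

theorem IsClosedUnder.killBasis_comp {S : ∀ k, Set (B k)} (hS : IsClosedUnder δ S) (k : ℕ)
    (x : B k →₀ R) : killBasis R (S (k + 1)) (δ k (killBasis R (S k) x)) =
      killBasis R (S (k + 1)) (δ k x) := by
  refine eq_of_eq_on_basis (S := Set.univ)
    (F := killBasis R (S (k + 1)) ∘ₗ δ k ∘ₗ killBasis R (S k))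
    (G := killBasis R (S (k + 1)) ∘ₗ δ k) (fun b _ => ?_) (Set.subset_univ _)
  by_cases hb : b ∈ S k
  · simp [killBasis_of_mem hb, killBasis_eq_zero (hS k b hb)]
  · simp [killBasis_of_notMem hb]

/-- A null-homotopy on a subcomplex spanned by basis vectors extends to a larger one containing a
given basis vector. -/
theorem exists_larger_homotopy (hδ : ∀ k, δ (k + 1) ∘ₗ δ k = 0)
    (hε : ∀ k, Function.Exact (ε k) (ε (k + 1))) (hε0 : Function.Injective (ε 0))
    (hp : ∀ k, IsPureMap (LinearMap.ker (ε k)).subtype)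
    (hf : ∀ k, ε k ∘ₗ f k = f (k + 1) ∘ₗ δ k)
    (S : ∀ k, Set (B k)) (hS : IsClosedUnder δ S) (s : ∀ k, (B (k + 1) →₀ R) →ₗ[R] E k)
    (hs : IsHomotopyOn δ ε f S s) (j : ℕ) (b₀ : B j) :
    ∃ (S' : ∀ k, Set (B k)) (s' : ∀ k, (B (k + 1) →₀ R) →ₗ[R] E k), IsClosedUnder δ S' ∧
      IsHomotopyOn δ ε f S' s' ∧ (∀ k, S k ⊆ S' k) ∧ b₀ ∈ S' j ∧
      ∀ k, ∀ b ∈ S (k + 1), s' k (Finsupp.single b 1) = s k (Finsupp.single b 1) := by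
  classical
  have hδ' : ∀ k x, δ (k + 1) (δ k x) = 0 := fun k x => LinearMap.congr_fun (hδ k) x
  have hf' : ∀ k x, ε k (f k x) = f (k + 1) (δ k x) := fun k x => LinearMap.congr_fun (hf k) x
  have hε' : ∀ k x, ε (k + 1) (ε k x) = 0 := fun k x => (hε k).apply_apply_eq_zero x
  -- The quotient by the subcomplex spanned by `S` is modelled on the same free modules, with
  -- differential `δ'`. The error `f'` of the homotopy `s` vanishes on `S`, hence is a chain map on
  -- this quotient.
  let p : ∀ k, (B k →₀ R) →ₗ[R] (B k →₀ R) := fun k => killBasis R (S k)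
  let δ' : ∀ k, (B k →₀ R) →ₗ[R] (B (k + 1) →₀ R) := fun k => p (k + 1) ∘ₗ δ k
  have hpδ : ∀ k x, p (k + 1) (δ k (p k x)) = p (k + 1) (δ k x) := hS.killBasis_comp
  let f' : ∀ k, (B k →₀ R) →ₗ[R] E k := fun k => match k with
    | 0 => f 0 - s 0 ∘ₗ δ 0
    | k + 1 => f (k + 1) - ε k ∘ₗ s k - s (k + 1) ∘ₗ δ (k + 1)
  have hf'S : ∀ k, ∀ b ∈ S k, f' k (Finsupp.single b 1) = 0 := by
    intro k b hb
    cases k with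
    | zero => simp [f', hs.1 b hb]
    | succ k => simp [f', hs.2 k b hb]
  have hf'p : ∀ k x, f' k (p k x) = f' k x := by
    intro k x
    refine eq_of_eq_on_basis (S := Set.univ) (F := f' k ∘ₗ p k) (G := f' k)
      (fun b _ => ?_) (Set.subset_univ _)
    by_cases hb : b ∈ S k
    · simp [p, killBasis_of_mem hb, hf'S k b hb]
    · simp [p, killBasis_of_notMem hb]
  have hf'c : ∀ k x, ε k (f' k x) = f' (k + 1) (δ k x) := by
    intro k x
    cases k with
    | zero => simp [f', hf', hδ']
    | succ k => simp [f', hf', hδ', hε']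
  obtain ⟨T, hUT, hT⟩ := exists_finite_closure (δ := δ')
    (Function.update (fun _ => ∅) j {b₀} : ∀ k, Finset (B k))
  obtain ⟨t, ht0, ht1⟩ := exists_homotopy_on_finite (δ := δ') (ε := ε) (f := f')
    (fun k => LinearMap.ext fun x => by simp [δ', hpδ, hδ']) hε hε0 hp
    (fun k => LinearMap.ext fun x => by simp [δ', hf'p, hf'c]) T hT
  have hb₀ : b₀ ∈ T j := hUT j (by simp)
  -- The correction `t` is composed with the projection that kills `S`, so it leaves the old
  -- homotopy untouched on `S`.
  refine ⟨fun k => S k ∪ T k, fun k => s k + t k ∘ₗ p (k + 1), ?_, ⟨?_, ?_⟩,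
    fun k => Set.subset_union_left, Or.inr hb₀, fun k b hb => by simp [p, killBasis_of_mem hb]⟩
  · intro k b hb
    by_cases hbS : b ∈ S k
    · exact (hS k b hbS).trans Set.subset_union_left
    · have hbT : b ∈ T k := hb.resolve_left hbS
      intro c hc
      by_cases hcS : c ∈ S (k + 1)
      · exact Or.inl hcS
      · refine Or.inr (hT k b hbT ?_)
        have := (killBasis_apply (S (k + 1)) (δ k (Finsupp.single b 1)) c).2 hcS
        simp only [Finset.mem_coe, Finsupp.mem_support_iff] at hc ⊢
        simpa [δ', p, this] using hc
  · intro b hb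
    by_cases hbS : b ∈ S 0
    · have : p 1 (δ 0 (Finsupp.single b 1)) = 0 := killBasis_eq_zero (hS 0 b hbS)
      simp [this, hs.1 b hbS]
    · have := ht0 b (hb.resolve_left hbS)
      simp only [f', δ', LinearMap.sub_apply, LinearMap.comp_apply] at this
      simp [← this]
  · intro k b hb
    by_cases hbS : b ∈ S (k + 1)
    · have h1 : p (k + 2) (δ (k + 1) (Finsupp.single b 1)) = 0 :=
        killBasis_eq_zero (hS (k + 1) b hbS)
      have h2 : p (k + 1) (Finsupp.single b 1) = 0 := killBasis_of_mem hbS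
      simp [h1, h2, hs.2 k b hbS]
    · have := ht1 k b (hb.resolve_left hbS)
      have h2 : p (k + 1) (Finsupp.single b 1) = Finsupp.single b 1 := killBasis_of_notMem hbS
      simp only [f', δ', LinearMap.sub_apply, LinearMap.comp_apply] at this
      simp only [LinearMap.add_apply, LinearMap.comp_apply, h2, map_add]
      rw [sub_sub, sub_eq_iff_eq_add] at this
      rw [this]; abel

/-- Every map from a complex of free modules to a pure acyclic complex is null-homotopic. -/
theorem exists_homotopy (hδ : ∀ k, δ (k + 1) ∘ₗ δ k = 0)
    (hε : ∀ k, Function.Exact (ε k) (ε (k + 1))) (hε0 : Function.Injective (ε 0))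
    (hp : ∀ k, IsPureMap (LinearMap.ker (ε k)).subtype)
    (hf : ∀ k, ε k ∘ₗ f k = f (k + 1) ∘ₗ δ k) :
    ∃ s, IsHomotopyOn δ ε f (fun _ => Set.univ) s := by
  classical
  let α := {p : (∀ k, Set (B k)) × (∀ k, (B (k + 1) →₀ R) →ₗ[R] E k) //
    IsClosedUnder δ p.1 ∧ IsHomotopyOn δ ε f p.1 p.2}
  -- Homotopies are compared only on the basis vectors already reached; their other values are
  -- irrelevant, so a chain has an upper bound obtained by gluing values on basis vectors.
  let r : α → α → Prop := fun p q => (∀ k, p.1.1 k ⊆ q.1.1 k) ∧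
    ∀ k, ∀ b ∈ p.1.1 (k + 1),
      q.1.2 k (Finsupp.single b 1) = p.1.2 k (Finsupp.single b 1)
  have rtrans : ∀ {a b c}, r a b → r b c → r a c := fun {a b c} h1 h2 =>
    ⟨fun k => (h1.1 k).trans (h2.1 k), fun k x hx => by
      rw [h2.2 k x (h1.1 _ hx), h1.2 k x hx]⟩
  obtain ⟨m, hm⟩ := exists_maximal_of_chains_bounded (r := r) (fun c hc => by
    have hs : ∀ k (b : B (k + 1)), ∃ n : E k, ∀ p ∈ c, b ∈ p.1.1 (k + 1) →
        p.1.2 k (Finsupp.single b 1) = n := by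
      intro k b
      by_cases h : ∃ p ∈ c, b ∈ p.1.1 (k + 1)
      · obtain ⟨p, hp, hb⟩ := h
        refine ⟨p.1.2 k (Finsupp.single b 1), fun q hq hbq => ?_⟩
        rcases eq_or_ne p q with rfl | hne
        · rfl
        rcases hc hp hq hne with h | h
        · exact h.2 k b hb
        · exact (h.2 k b hbq).symm
      · exact ⟨0, fun p hp hb => absurd ⟨p, hp, hb⟩ h⟩
    choose n hn using hs
    let S : ∀ k, Set (B k) := fun k => ⋃ p ∈ c, p.1.1 k
    let s : ∀ k, (B (k + 1) →₀ R) →ₗ[R] E k := fun k => Finsupp.linearCombination R (n k)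
    have hsub : ∀ p ∈ c, ∀ k, p.1.1 k ⊆ S k := fun p hp k x hx =>
      Set.mem_biUnion hp hx
    have hsb : ∀ p ∈ c, ∀ k, ∀ b ∈ p.1.1 (k + 1),
        s k (Finsupp.single b 1) = p.1.2 k (Finsupp.single b 1) := fun p hp k b hb => by
      simp [s, hn k b p hp hb]
    have hsx : ∀ p ∈ c, ∀ k, ∀ x : B (k + 1) →₀ R, (x.support : Set (B (k + 1))) ⊆ p.1.1 (k + 1) →
        s k x = p.1.2 k x := fun p hp k x hx => eq_of_eq_on_basis (hsb p hp k) hx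
    refine ⟨⟨⟨S, s⟩, fun k b hb => ?_, fun b hb => ?_, fun k b hb => ?_⟩,
      fun p hp => ⟨hsub p hp, hsb p hp⟩⟩
    · obtain ⟨p, hp, hb⟩ := Set.mem_iUnion₂.1 hb
      exact (p.2.1 k b hb).trans (hsub p hp _)
    · obtain ⟨p, hp, hb⟩ := Set.mem_iUnion₂.1 hb
      rw [hsx p hp 0 _ (p.2.1 0 b hb)]
      exact p.2.2.1 b hb
    · obtain ⟨p, hp, hb⟩ := Set.mem_iUnion₂.1 hb
      rw [hsx p hp _ _ (p.2.1 (k + 1) b hb)]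
      change _ = ε k (s k _) + _
      rw [hsb p hp k b hb]
      exact p.2.2.2 k b hb) rtrans
  refine ⟨m.1.2, ?_⟩
  have : m.1.1 = fun _ => Set.univ := by
    funext j
    refine Set.eq_univ_of_forall fun b₀ => ?_
    obtain ⟨S', s', h1, h2, h3, h4, h5⟩ := exists_larger_homotopy hδ hε hε0 hp hf m.1.1 m.2.1
      m.1.2 m.2.2 j b₀
    exact (hm ⟨⟨S', s'⟩, h1, h2⟩ ⟨h3, h5⟩).1 j h4
  rw [← this]
  exact m.2.2

end NullHomotopy

/-! ### From local exactness to genuine extensions -/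

section Extension

variable {R : Type u} [Ring R] {P : ℕ → Type u} [∀ k, AddCommGroup (P k)] [∀ k, Module R (P k)]
  (d : ∀ k, P k →ₗ[R] P (k + 1))

theorem IsPureMap.subtype_ker {L C D : Type u} [AddCommGroup L] [AddCommGroup C] [AddCommGroup D]
    [Module R L] [Module R C] [Module R D] {i : L →ₗ[R] C} (hi : IsPureMap i) {p : C →ₗ[R] D}
    (h : Function.Exact i p) : IsPureMap (LinearMap.ker p).subtype := by
  intro Q _ _ _ A g hg
  obtain ⟨g', hg'⟩ := hi Q A g fun x hx => (h _).1 (by simpa using hg x hx)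
  exact ⟨(i.codRestrict (LinearMap.ker p) fun x => h.apply_apply_eq_zero x) ∘ₗ g',
    fun x hx => hg' x hx⟩

/-- A map to a locally exact module that kills boundaries in degree `k + 1`. -/
structure LocallyExactCocycle (k : ℕ) where
  L : ModuleCat.{u} R
  exact : ∀ j, LocallyExact (d j) (d (j + 1)) L
  g : P (k + 1) →ₗ[R] L
  comp_d : g ∘ₗ d k = 0

variable {d}

/-- One step of the pure resolution: embed into a reduced power where the cocycle extends, and pass
to the quotient. The quotient is again locally exact and the extension induces the next cocycle, so
the step can be iterated. -/
theorem LocallyExactCocycle.exists_next [∀ k, Module.Projective R (P k)] {k : ℕ}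
    (z : LocallyExactCocycle (R := R) d k) :
    ∃ (C : ModuleCat.{u} R) (z' : LocallyExactCocycle (R := R) d (k + 1))
      (i : z.L →ₗ[R] C) (p : C →ₗ[R] z'.L) (c : P (k + 2) →ₗ[R] C),
      Function.Injective i ∧ Function.Surjective p ∧ Function.Exact i p ∧ IsPureMap i ∧
      c ∘ₗ d (k + 1) = i ∘ₗ z.g ∧ p ∘ₗ c = z'.g := by
  classical
  obtain ⟨c, hc⟩ := (z.exact k).exists_germ_extension z.g z.comp_d
  let l : Filter (Finset (P (k + 1))) := Filter.atTop
  let i : z.L →ₗ[R] Filter.Germ l z.L := germConst l z.L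
  let p := (LinearMap.range i).mkQ
  have hip : Function.Exact i p := fun x => by simp [p]
  have hp : Function.Surjective p := Submodule.mkQ_surjective _
  refine ⟨ModuleCat.of R (Filter.Germ l z.L), ⟨ModuleCat.of R (_ ⧸ LinearMap.range i),
    fun j => ((z.exact j).germ l).of_pure_quotient (isPureMap_germConst l) hp hip,
    p ∘ₗ c, ?_⟩, i, p, c, germConst_injective l, hp, hip, isPureMap_germConst l, hc, rfl⟩
  rw [LinearMap.comp_assoc, hc]
  exact LinearMap.ext fun x => hip.apply_apply_eq_zero (z.g x)

/-- In a complex of projective modules that is locally exact with respect to `N`, a map to `N`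
that kills the boundaries extends along the differential. -/
theorem exists_extension_of_locallyExact [∀ k, Module.Projective R (P k)]
    (hd : ∀ k, d (k + 1) ∘ₗ d k = 0) {N : Type u} [AddCommGroup N] [Module R N]
    (hN : ∀ k, LocallyExact (d k) (d (k + 1)) N) (g : P 1 →ₗ[R] N) (hg : g ∘ₗ d 0 = 0) :
    ∃ h : P 2 →ₗ[R] N, h ∘ₗ d 1 = g := by
  choose C nxt i p c hi hp hip hpure hc hpc using
    fun k (z : LocallyExactCocycle (R := R) d k) => z.exists_next
  let z : ∀ k, LocallyExactCocycle (R := R) d k := fun k =>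
    Nat.rec ⟨ModuleCat.of R N, hN, g, hg⟩ nxt k
  -- Splicing the short pure exact sequences gives `0 → N → C₀ → C₁ → ⋯`, with `N` in degree `0`.
  let E : ℕ → ModuleCat.{u} R := fun k => match k with
    | 0 => (z 0).L
    | k + 1 => C k (z k)
  let ε : ∀ k, E k →ₗ[R] E (k + 1) := fun k => match k with
    | 0 => i 0 (z 0)
    | k + 1 => i (k + 1) (z (k + 1)) ∘ₗ p k (z k)
  -- The null-homotopy theorem needs free modules. Each `P k` is a retract of the free module on its
  -- elements, and the differential is transported along `e` and `σ`.
  choose σ hσ using fun k => (Module.projective_def' (R := R) (P := P k)).1 inferInstance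
  let e : ∀ k, (P k →₀ R) →ₗ[R] P k := fun k => Finsupp.linearCombination R id
  have hσ' : ∀ k x, e k (σ k x) = x := fun k x => LinearMap.congr_fun (hσ k) x
  let δ : ∀ k, (P (k + 1) →₀ R) →ₗ[R] (P (k + 2) →₀ R) := fun k =>
    σ (k + 2) ∘ₗ d (k + 1) ∘ₗ e (k + 1)
  let f : ∀ k, (P (k + 1) →₀ R) →ₗ[R] E k := fun k => match k with
    | 0 => (z 0).g ∘ₗ e 1
    | k + 1 => c k (z k) ∘ₗ e (k + 2)
  have hd' : ∀ k x, d (k + 1) (d k x) = 0 := fun k x => LinearMap.congr_fun (hd k) x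
  have hc' : ∀ k x, c k (z k) (d (k + 1) x) = i k (z k) ((z k).g x) := fun k x =>
    LinearMap.congr_fun (hc k (z k)) x
  have hpc' : ∀ k x, p k (z k) (c k (z k) x) = (z (k + 1)).g x := fun k x =>
    LinearMap.congr_fun (hpc k (z k)) x
  have hex : ∀ k, Function.Exact (ε k) (ε (k + 1)) := by
    intro k
    have h1 : Function.Exact (i k (z k)) (ε (k + 1)) := fun x => by
      change i (k + 1) (z (k + 1)) (p k (z k) x) = 0 ↔ _
      rw [← hip k (z k) x]
      exact map_eq_zero_iff _ (hi (k + 1) (z (k + 1)))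
    cases k with
    | zero => exact h1
    | succ k =>
      intro x
      rw [h1 x]
      constructor
      · rintro ⟨y, rfl⟩
        obtain ⟨y, rfl⟩ := hp k (z k) y
        exact ⟨y, rfl⟩
      · rintro ⟨y, rfl⟩
        exact ⟨p k (z k) y, rfl⟩
  have hpu : ∀ k, IsPureMap (LinearMap.ker (ε k)).subtype := by
    intro k
    cases k with
    | zero =>
      intro Q _ _ _ A q hq
      refine ⟨0, fun x hx => ?_⟩
      have h0 : ε 0 (q x) = 0 := by simpa using hq x hx
      have : q x = 0 := hi 0 (z 0) (h0.trans (map_zero _).symm)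
      simp [this]
    | succ k =>
      refine (hpure k (z k)).subtype_ker fun x => ?_
      change i (k + 1) (z (k + 1)) (p k (z k) x) = 0 ↔ _
      rw [← hip k (z k) x]
      exact map_eq_zero_iff _ (hi (k + 1) (z (k + 1)))
  obtain ⟨s, hs, -⟩ := exists_homotopy (B := fun k => P (k + 1)) (E := fun k => E k)
    (δ := δ) (ε := ε) (f := f) (fun k => LinearMap.ext fun x => by simp [δ, hσ', hd']) hex
    (hi 0 (z 0)) hpu (fun k => LinearMap.ext fun x => by
      cases k with
      | zero =>
        change i 0 (z 0) ((z 0).g (e 1 x)) = c 0 (z 0) (e 2 (σ 2 (d 1 (e 1 x))))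
        rw [hσ', hc']
      | succ k =>
        change i (k + 1) (z (k + 1)) (p k (z k) (c k (z k) (e (k + 2) x))) =
          c (k + 1) (z (k + 1)) (e (k + 3) (σ (k + 3) (d (k + 2) (e (k + 2) x))))
        rw [hσ', hc', hpc'])
  -- There is nothing below degree `0` in `E`, so the homotopy equation there says that `g` factors
  -- through the differential.
  refine ⟨s 0 ∘ₗ σ 2, LinearMap.ext fun x => ?_⟩
  have : f 0 = s 0 ∘ₗ δ 0 := by
    ext b; simpa using hs b trivial
  have h2 : g (e 1 (σ 1 x)) = s 0 (σ 2 (d 1 (e 1 (σ 1 x)))) := LinearMap.congr_fun this (σ 1 x)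
  rw [hσ'] at h2
  exact h2.symm

end Extension

/-! ### Extending and separating characters -/

section Characters

theorem exists_character_extension {A B : Type*} [AddCommGroup A] [AddCommGroup B] {i : A →+ B}
    (hi : Function.Injective i) (χ : A →+ AddCircle (1 : ℚ)) :
    ∃ χ' : B →+ AddCircle (1 : ℚ), ∀ x, χ' (i x) = χ x := by
  obtain ⟨χ', h⟩ := CharacterModule.dual_surjective_of_injective (R := ℤ) i.toIntLinearMap hi χ
  exact ⟨χ', fun x => DFunLike.congr_fun h x⟩

theorem exists_character_separating {A : Type*} [AddCommGroup A] (H : AddSubgroup A) {x : A}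
    (hx : x ∉ H) : ∃ χ : A →+ AddCircle (1 : ℚ), (∀ y ∈ H, χ y = 0) ∧ χ x ≠ 0 := by
  have : (QuotientAddGroup.mk x : A ⧸ H) ≠ 0 := fun h =>
    hx ((QuotientAddGroup.eq_zero_iff x).1 h)
  obtain ⟨χ, hχ⟩ := CharacterModule.exists_character_apply_ne_zero_of_ne_zero this
  exact ⟨AddMonoidHom.comp (show A ⧸ H →+ AddCircle (1 : ℚ) from χ) (QuotientAddGroup.mk' H),
    fun y hy => by
      have : (QuotientAddGroup.mk' H y : A ⧸ H) = 0 := (QuotientAddGroup.eq_zero_iff y).2 hy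
      rw [AddMonoidHom.comp_apply, this, map_zero], hχ⟩

end Characters

/-! ### Character modules over a noncommutative ring -/

section Duals

variable {R : Type u} [Ring R]

/-- The character module of a left module, as a right module. -/
def RightDual (F : Type u) [AddCommGroup F] : Type u := F →+ AddCircle (1 : ℚ)

/-- The character module of a right module, as a left module. -/
def LeftDual (I : Type u) [AddCommGroup I] : Type u := I →+ AddCircle (1 : ℚ)

instance (F : Type u) [AddCommGroup F] : AddCommGroup (RightDual F) :=
  inferInstanceAs (AddCommGroup (F →+ AddCircle (1 : ℚ)))

instance (I : Type u) [AddCommGroup I] : AddCommGroup (LeftDual I) :=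
  inferInstanceAs (AddCommGroup (I →+ AddCircle (1 : ℚ)))

instance (F : Type u) [AddCommGroup F] : FunLike (RightDual F) F (AddCircle (1 : ℚ)) :=
  inferInstanceAs (FunLike (F →+ AddCircle (1 : ℚ)) F (AddCircle (1 : ℚ)))

instance (F : Type u) [AddCommGroup F] :
    AddMonoidHomClass (RightDual F) F (AddCircle (1 : ℚ)) :=
  inferInstanceAs (AddMonoidHomClass (F →+ AddCircle (1 : ℚ)) F (AddCircle (1 : ℚ)))

instance (I : Type u) [AddCommGroup I] : FunLike (LeftDual I) I (AddCircle (1 : ℚ)) :=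
  inferInstanceAs (FunLike (I →+ AddCircle (1 : ℚ)) I (AddCircle (1 : ℚ)))

instance (I : Type u) [AddCommGroup I] :
    AddMonoidHomClass (LeftDual I) I (AddCircle (1 : ℚ)) :=
  inferInstanceAs (AddMonoidHomClass (I →+ AddCircle (1 : ℚ)) I (AddCircle (1 : ℚ)))

instance (F : Type u) [AddCommGroup F] [Module R F] : Module Rᵐᵒᵖ (RightDual F) where
  smul r χ := AddMonoidHom.comp χ (DistribSMul.toAddMonoidHom F r.unop)
  one_smul χ := DFunLike.ext _ _ fun x => congrArg χ (one_smul R x)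
  mul_smul r s χ := DFunLike.ext _ _ fun x => congrArg χ (mul_smul s.unop r.unop x)
  smul_zero _ := rfl
  smul_add _ _ _ := rfl
  add_smul r s χ := DFunLike.ext _ _ fun x =>
    (congrArg χ (add_smul r.unop s.unop x)).trans (map_add χ _ _)
  zero_smul χ := DFunLike.ext _ _ fun x => (congrArg χ (zero_smul R x)).trans (map_zero χ)

instance (I : Type u) [AddCommGroup I] [Module Rᵐᵒᵖ I] : Module R (LeftDual I) where
  smul r χ := AddMonoidHom.comp χ (DistribSMul.toAddMonoidHom I (MulOpposite.op r))
  one_smul χ := DFunLike.ext _ _ fun x => congrArg χ (one_smul Rᵐᵒᵖ x)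
  mul_smul r s χ := DFunLike.ext _ _ fun x =>
    congrArg χ (mul_smul (MulOpposite.op s) (MulOpposite.op r) x)
  smul_zero _ := rfl
  smul_add _ _ _ := rfl
  add_smul r s χ := DFunLike.ext _ _ fun x =>
    (congrArg χ (add_smul (MulOpposite.op r) (MulOpposite.op s) x)).trans (map_add χ _ _)
  zero_smul χ := DFunLike.ext _ _ fun x => (congrArg χ (zero_smul Rᵐᵒᵖ x)).trans (map_zero χ)

theorem RightDual.smul_apply {F : Type u} [AddCommGroup F] [Module R F] (r : Rᵐᵒᵖ)
    (χ : RightDual F) (x : F) : (r • χ) x = χ (r.unop • x) := rfl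

theorem LeftDual.smul_apply {I : Type u} [AddCommGroup I] [Module Rᵐᵒᵖ I] (r : R)
    (χ : LeftDual I) (x : I) : (r • χ) x = χ (MulOpposite.op r • x) := rfl

theorem RightDual.sum_apply {F : Type u} [AddCommGroup F] {κ : Type*} (s : Finset κ)
    (χ : κ → RightDual F) (x : F) : (∑ k ∈ s, χ k) x = ∑ k ∈ s, χ k x :=
  map_sum (AddMonoidHom.eval x : (F →+ AddCircle (1 : ℚ)) →+ AddCircle (1 : ℚ)) χ s

/-- The character module of a projective module is an injective right module. -/
theorem injective_rightDual (F : Type u) [AddCommGroup F] [Module R F] [Module.Projective R F] :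
    Injective (ModuleCat.of Rᵐᵒᵖ (RightDual F)) := by
  obtain ⟨σ, hσ⟩ := (Module.projective_def' (R := R) (P := F)).1 inferInstance
  refine ⟨fun {Y Y'} f i hi => ?_⟩
  have hinj : Function.Injective i.hom := (ModuleCat.mono_iff_injective i).1 hi
  -- The evaluations `y ↦ f y b` are extended to `Y'` merely as characters, one for each `b`.
  -- Reassembling them through the linear coordinates `σ` restores linearity over the ring.
  choose c hc using fun b : F => exists_character_extension (i := i.hom.toAddMonoidHom) hinj
    { toFun := fun y => f.hom y b
      map_zero' := by rw [map_zero]; rfl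
      map_add' := fun y z => by rw [map_add]; rfl }
  have hc' : ∀ b y, c b (i.hom y) = f.hom y b := hc
  let t : Y' → F →+ AddCircle (1 : ℚ) := fun y =>
    (Finsupp.liftAddHom fun b : F =>
      { toFun := fun r : R => c b (MulOpposite.op r • y)
        map_zero' := by simp
        map_add' := fun r s => by simp [add_smul] }).comp σ.toAddMonoidHom
  have ht : ∀ y x, t y x = (σ x).sum fun b r => c b (MulOpposite.op r • y) := fun y x => rfl
  have hadd : ∀ y z, t (y + z) = t y + t z := fun y z => by
    refine AddMonoidHom.ext fun x => ?_
    rw [AddMonoidHom.add_apply, ht, ht, ht, ← Finsupp.sum_add]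
    simp only [smul_add, map_add]
  have hsmul : ∀ (r : Rᵐᵒᵖ) y x, t (r • y) x = t y (r.unop • x) := fun r y x => by
    rw [ht, ht, map_smul, Finsupp.sum_smul_index (by simp)]
    simp only [smul_smul, MulOpposite.op_mul, MulOpposite.op_unop]
  refine ⟨ModuleCat.ofHom
    { toFun := fun y => (t y : RightDual F)
      map_add' := hadd
      map_smul' := fun r y => DFunLike.ext _ _ (hsmul r y) }, ?_⟩
  ext y
  refine DFunLike.ext (F := RightDual F) _ _ fun x => ?_
  change t (i.hom y) x = f.hom y x
  have hx : Finsupp.linearCombination R id (σ x) = x := LinearMap.congr_fun hσ x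
  conv_rhs => rw [← hx]
  rw [ht, Finsupp.linearCombination_apply, map_finsuppSum]
  refine Finsupp.sum_congr fun b _ => ?_
  rw [← map_smul, hc', map_smul]
  rfl

end Duals

/-! ### Hom-tensor duality and local exactness from tensor exactness -/

section TensorCharacters

variable {R : Type u} [Ring R]

/-- The image of `x ⊗ p` in the tensor product over `R`. -/
def Tensor.mk (I : ModuleCat.{u} Rᵐᵒᵖ) (P : ModuleCat.{u} R) (x : I) (p : P) : Tensor I P :=
  (balancedRel I P).mkQ (x ⊗ₜ[ℤ] p)

variable {I : ModuleCat.{u} Rᵐᵒᵖ} {P Q : ModuleCat.{u} R}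

theorem Tensor.induction {p : Tensor I P → Prop} (h0 : p 0)
    (hmk : ∀ x y, p (Tensor.mk I P x y)) (hadd : ∀ s t, p s → p t → p (s + t)) (t : Tensor I P) :
    p t := by
  obtain ⟨t, rfl⟩ := (balancedRel I P).mkQ_surjective t
  induction t using TensorProduct.induction_on with
  | zero => rwa [map_zero]
  | tmul x y => exact hmk x y
  | add s t hs ht => rw [map_add]; exact hadd _ _ hs ht

theorem Tensor.mk_add_left (x y : I) (p : P) :
    Tensor.mk I P (x + y) p = Tensor.mk I P x p + Tensor.mk I P y p := by
  rw [Tensor.mk, TensorProduct.add_tmul, map_add]; rfl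

theorem Tensor.mk_add_right (x : I) (p q : P) :
    Tensor.mk I P x (p + q) = Tensor.mk I P x p + Tensor.mk I P x q := by
  rw [Tensor.mk, TensorProduct.tmul_add, map_add]; rfl

theorem Tensor.mk_smul (x : I) (r : R) (p : P) :
    Tensor.mk I P x (r • p) = Tensor.mk I P (MulOpposite.op r • x) p := by
  refine ((Submodule.Quotient.eq (balancedRel I P)).2 ?_).symm
  exact Submodule.subset_span ⟨x, r, p, rfl⟩

theorem Tensor.map_mk (f : P ⟶ Q) (x : I) (p : P) :
    Tensor.map I f (Tensor.mk I P x p) = Tensor.mk I Q x (f.hom p) := rfl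

/-- The additive map `x ↦ x ⊗ p`. -/
def Tensor.mkLeft (I : ModuleCat.{u} Rᵐᵒᵖ) {P : ModuleCat.{u} R} (p : P) : I →+ Tensor I P :=
  AddMonoidHom.mk' (fun x => Tensor.mk I P x p) fun x y => Tensor.mk_add_left x y p

/-- The additive map `p ↦ x ⊗ p`. -/
def Tensor.mkRight {I : ModuleCat.{u} Rᵐᵒᵖ} (P : ModuleCat.{u} R) (x : I) : P →+ Tensor I P :=
  AddMonoidHom.mk' (fun p => Tensor.mk I P x p) fun p q => Tensor.mk_add_right x p q

/-- The character of `I ⊗ P` given by a linear map from `P` to the character module of `I`. -/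
noncomputable def tensorCharacter (g : P →ₗ[R] LeftDual I) :
    Tensor I P →ₗ[ℤ] AddCircle (1 : ℚ) :=
  (balancedRel I P).liftQ (TensorProduct.liftAddHom
    (AddMonoidHom.flip (AddMonoidHom.mk' (fun p => (g p : I →+ AddCircle (1 : ℚ)))
      fun p q => map_add g p q)) (fun r x p => by
        change g p (r • x) = g (r • p) x
        rw [map_zsmul, map_zsmul]; rfl)).toIntLinearMap (by
    refine Submodule.span_le.2 ?_
    rintro _ ⟨x, r, p, rfl⟩
    change _ = (0 : AddCircle (1 : ℚ))
    rw [map_sub]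
    change g p (MulOpposite.op r • x) - g (r • p) x = 0
    exact sub_eq_zero.2 (DFunLike.congr_fun (map_smul g r p) x).symm)

theorem tensorCharacter_mk (g : P →ₗ[R] LeftDual I) (x : I) (p : P) :
    tensorCharacter g (Tensor.mk I P x p) = g p x := rfl

theorem tensorCharacter_zero (t : Tensor I P) :
    tensorCharacter (0 : P →ₗ[R] LeftDual I) t = 0 := by
  induction t using Tensor.induction with
  | h0 => simp
  | hmk x y => rfl
  | hadd s t hs ht => rw [map_add, hs, ht, add_zero]

theorem tensorCharacter_map (f : P ⟶ Q) (g : Q →ₗ[R] LeftDual I) (t : Tensor I P) :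
    tensorCharacter g (Tensor.map I f t) = tensorCharacter (g ∘ₗ f.hom) t := by
  induction t using Tensor.induction with
  | h0 => simp
  | hmk x y => rfl
  | hadd s t hs ht => rw [map_add, map_add, map_add, hs, ht]

/-- The linear map to the character module given by a character of the tensor product. -/
noncomputable def homOfCharacter (χ : Tensor I P →+ AddCircle (1 : ℚ)) : P →ₗ[R] LeftDual I where
  toFun p := (χ.comp (Tensor.mkLeft I p) : I →+ AddCircle (1 : ℚ))
  map_add' p q := DFunLike.ext (F := LeftDual I) _ _ fun x =>
    (congrArg χ (Tensor.mk_add_right x p q)).trans (map_add χ _ _)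
  map_smul' r p := DFunLike.ext (F := LeftDual I) _ _ fun x => congrArg χ (Tensor.mk_smul x r p)

theorem tensorCharacter_homOfCharacter (χ : Tensor I P →+ AddCircle (1 : ℚ)) (t : Tensor I P) :
    tensorCharacter (homOfCharacter χ) t = χ t := by
  induction t using Tensor.induction with
  | h0 => simp
  | hmk x y => rfl
  | hadd s t hs ht => rw [map_add, map_add, hs, ht]

variable {P' P'' : ModuleCat.{u} R} {a : P' ⟶ P} {b : P ⟶ P''}

/-- Linear maps `P → LeftDual I` are the characters of `I ⊗ P`, and characters extend along
injections because the circle group is divisible. -/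
theorem hom_exact_of_tensor_exact (h : Function.Exact (Tensor.map I a) (Tensor.map I b))
    (g : P →ₗ[R] LeftDual I) (hg : g ∘ₗ a.hom = 0) :
    ∃ h : P'' →ₗ[R] LeftDual I, h ∘ₗ b.hom = g := by
  have hker : LinearMap.ker (Tensor.map I b) ≤ LinearMap.ker (tensorCharacter g) := by
    intro t ht
    obtain ⟨s, rfl⟩ := (h t).1 ht
    rw [LinearMap.mem_ker, tensorCharacter_map, hg, tensorCharacter_zero]
  let χ := (LinearMap.ker (Tensor.map I b)).liftQ (tensorCharacter g) hker
  let i := (LinearMap.ker (Tensor.map I b)).liftQ (Tensor.map I b) le_rfl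
  have hi : Function.Injective i := LinearMap.ker_eq_bot.1 (Submodule.ker_liftQ_eq_bot _ _ _ le_rfl)
  obtain ⟨χ', hχ'⟩ := exists_character_extension (i := i.toAddMonoidHom) hi χ.toAddMonoidHom
  refine ⟨homOfCharacter χ', LinearMap.ext fun p => DFunLike.ext (F := LeftDual I) _ _ fun x => ?_⟩
  exact hχ' (Submodule.Quotient.mk (Tensor.mk I P x p))

theorem tensor_exact_of_hom_exact (hab : a ≫ b = 0)
    (h : ∀ g : P →ₗ[R] LeftDual I, g ∘ₗ a.hom = 0 →
      ∃ h : P'' →ₗ[R] LeftDual I, h ∘ₗ b.hom = g) :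
    Function.Exact (Tensor.map I a) (Tensor.map I b) := by
  intro t
  constructor
  · intro ht
    by_contra hne
    obtain ⟨χ, hχ, hχt⟩ := exists_character_separating
      (LinearMap.range (Tensor.map I a)).toAddSubgroup (x := t) hne
    obtain ⟨k, hk⟩ := h (homOfCharacter χ) (LinearMap.ext fun p =>
      DFunLike.ext (F := LeftDual I) _ _ fun x => hχ _ ⟨Tensor.mk I P' x p, rfl⟩)
    apply hχt
    rw [← tensorCharacter_homOfCharacter, ← hk, ← tensorCharacter_map, ht, map_zero]
  · rintro ⟨s, rfl⟩
    induction s using Tensor.induction with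
    | h0 => simp
    | hmk x y =>
      rw [Tensor.map_mk, Tensor.map_mk]
      have : b.hom (a.hom y) = 0 := congrArg (fun f => f.hom y) hab
      rw [this]
      exact map_zero (Tensor.mkRight P'' x)
    | hadd s t hs ht => rw [map_add, map_add, hs, ht, add_zero]

/-- A tensor involves finitely many elements of `P`; this is the source of the finite set in local
exactness. -/
theorem exists_finset_tensorCharacter_eq_zero (y : Tensor I P) :
    ∃ T : Finset P, ∀ ψ : P →ₗ[R] LeftDual I, (∀ t ∈ T, ψ t = 0) → tensorCharacter ψ y = 0 := by
  classical
  induction y using Tensor.induction with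
  | h0 => exact ⟨∅, fun _ _ => map_zero _⟩
  | hmk x p =>
    refine ⟨{p}, fun ψ h => ?_⟩
    rw [tensorCharacter_mk, h p (Finset.mem_singleton_self p)]
    rfl
  | hadd s t hs ht =>
    obtain ⟨S, hS⟩ := hs
    obtain ⟨T, hT⟩ := ht
    exact ⟨S ∪ T, fun ψ h => by
      rw [map_add, hS ψ fun t ht => h t (Finset.mem_union_left _ ht),
        hT ψ fun t ht => h t (Finset.mem_union_right _ ht), add_zero]⟩

/-- If a sequence of projective modules stays exact after tensoring with injective modules, it is
locally exact with respect to projective modules. -/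
theorem locallyExact_of_tensor_exact [Module.Projective R P'']
    (h : ∀ I : ModuleCat.{u} Rᵐᵒᵖ, Injective I →
      Function.Exact (Tensor.map I a) (Tensor.map I b))
    (F : Type u) [AddCommGroup F] [Module R F] [Module.Projective R F] :
    LocallyExact a.hom b.hom F := by
  classical
  by_contra hcon
  simp only [LocallyExact, not_forall, not_exists] at hcon
  obtain ⟨S, hS⟩ := hcon
  choose g hg hgS using hS
  let ρ : (P'' →ₗ[R] F) →+ (S → F) :=
    { toFun := fun k s => k (b.hom s), map_zero' := rfl, map_add' := fun _ _ => rfl }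
  have hne : ∀ T, (fun s : S => g T s) ∉ ρ.range := by
    rintro T ⟨k, hk⟩
    obtain ⟨s, hs, hs'⟩ : ∃ s, ∃ _ : s ∈ S, ¬ g T s = k (b.hom s) := by
      simpa only [not_forall] using hgS T k
    exact hs' (congrFun hk ⟨s, hs⟩).symm
  choose χ hχ hχne using fun T => exists_character_separating ρ.range (hne T)
  -- The counterexamples for all finite sets `T` are collected in one injective right module, the
  -- dual of a direct sum of copies of `F` indexed by `T`.
  let η : S → RightDual (Finset P' →₀ F) := fun s =>
    (Finsupp.liftAddHom fun T => (χ T).comp (AddMonoidHom.single (fun _ : S => F) s) :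
      (Finset P' →₀ F) →+ AddCircle (1 : ℚ))
  have hη : ∀ s T x, η s (Finsupp.single T x) = χ T (Pi.single s x) := fun s T x =>
    Finsupp.liftAddHom_apply_single _ _ _
  have hχsum : ∀ T (v : S → F), ∑ s, χ T (Pi.single s (v s)) = χ T v := fun T v => by
    rw [← map_sum, Finset.univ_sum_single]
  let J := ModuleCat.of Rᵐᵒᵖ (RightDual (Finset P' →₀ F))
  have : Module.Projective R (Finset P' →₀ F) :=
    Module.Projective.of_equiv (finsuppLequivDFinsupp R).symm
  have hJ : Injective J := injective_rightDual (R := R) (Finset P' →₀ F)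
  -- Each `χ T` kills the tuples `k (b s)` with `k` linear. Expanding `b s` in finite coordinates
  -- turns this into the vanishing of the image of `x` under `b`.
  let x : Tensor J P := ∑ s : S, Tensor.mk J P (η s) (s : P)
  obtain ⟨U, φ, hφ⟩ := exists_finite_coordinates (R := R) (S.image b.hom)
  have hx : Tensor.map J b x = 0 := by
    have h1 : ∀ s : S, Tensor.map J b (Tensor.mk J P (η s) (s : P)) =
        ∑ u ∈ U, Tensor.mkLeft J u (MulOpposite.op (φ u (b.hom s)) • η s : RightDual _) := by
      intro s
      rw [Tensor.map_mk]
      conv_lhs => rw [← hφ _ (Finset.mem_image_of_mem b.hom s.2)]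
      refine (map_sum (Tensor.mkRight P'' (I := J) (η s)) _ _).trans ?_
      exact Finset.sum_congr rfl fun u _ => Tensor.mk_smul (I := J) _ _ _
    have h2 : ∀ u, ∑ s : S, (MulOpposite.op (φ u (b.hom s)) • η s : RightDual _) = 0 := by
      intro u
      refine DFunLike.ext (F := RightDual _) _ _ fun v => ?_
      induction v using Finsupp.induction_linear with
      | zero => rw [map_zero, map_zero]
      | add v w hv hw => rw [map_add, map_add, hv, hw]
      | single T v =>
        rw [RightDual.sum_apply]
        simp only [RightDual.smul_apply, MulOpposite.unop_op, Finsupp.smul_single, hη]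
        rw [hχsum T fun s => φ u (b.hom s) • v]
        exact hχ T _ ⟨(φ u).smulRight v, rfl⟩
    rw [map_sum, Finset.sum_congr rfl fun s _ => h1 s, Finset.sum_comm]
    refine Finset.sum_eq_zero fun u _ => ?_
    rw [← map_sum]
    refine (congrArg (Tensor.mkLeft J u) (h2 u)).trans (map_zero _)
  obtain ⟨y, hy⟩ := (h J hJ x).1 hx
  obtain ⟨T, hT⟩ := exists_finset_tensorCharacter_eq_zero y
  -- With `T` now fixed by the preimage `y`, the map `g T` placed in the summand `T` pairs with `x`
  -- to give `χ T (g T) ≠ 0`. Pulled back along `a` it vanishes on `T`, hence pairs to zero with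
  -- `y`: a contradiction.
  let G : P →ₗ[R] LeftDual J :=
    { toFun := fun p => (AddMonoidHom.mk' (fun ξ : RightDual (Finset P' →₀ F) =>
        ξ (Finsupp.single T (g T p))) fun _ _ => rfl : J →+ AddCircle (1 : ℚ))
      map_add' := fun p q => DFunLike.ext (F := LeftDual J) _ _ fun ξ => by
        change (ξ : RightDual _) (Finsupp.single T (g T (p + q))) = _
        rw [map_add, Finsupp.single_add, map_add]; rfl
      map_smul' := fun r p => DFunLike.ext (F := LeftDual J) _ _ fun ξ => by
        change (ξ : RightDual _) (Finsupp.single T (g T (r • p))) = _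
        rw [map_smul, ← Finsupp.smul_single]; rfl }
  have hG : tensorCharacter G x = χ T (fun s : S => g T s) := by
    rw [map_sum, ← hχsum T fun s : S => g T s]
    exact Finset.sum_congr rfl fun s _ => hη s T (g T s)
  refine hχne T ?_
  rw [← hG, ← hy, tensorCharacter_map]
  refine hT _ fun t ht => DFunLike.ext (F := LeftDual J) _ _ fun ξ => ?_
  change (ξ : RightDual _) (Finsupp.single T (g T (a.hom t))) = 0
  rw [hg T t ht, Finsupp.single_zero, map_zero]

end TensorCharacters

/-! ### Vanishing of `Ext` along short exact sequences -/

section Ext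

open Abelian

variable {R : Type u} [Ring R] {S : ShortComplex (ModuleCat.{u} R)}

theorem ext_subsingleton_of_retract {X Y W : ModuleCat.{u} R} {n : ℕ} (i : X ⟶ Y) (r : Y ⟶ X)
    (h : i ≫ r = 𝟙 X) (hY : Subsingleton (Ext Y W n)) : Subsingleton (Ext X W n) := by
  refine subsingleton_of_forall_eq 0 fun e => ?_
  have : (Ext.mk₀ r).comp e (zero_add n) = 0 := Subsingleton.elim _ _
  rw [← Ext.mk₀_id_comp e, ← h, ← Ext.mk₀_comp_mk₀_assoc, this, Ext.comp_zero]

theorem ext_subsingleton_X₂ (hS : S.ShortExact) {W : ModuleCat.{u} R} {n : ℕ}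
    (h₁ : Subsingleton (Ext S.X₁ W n)) (h₃ : Subsingleton (Ext S.X₃ W n)) :
    Subsingleton (Ext S.X₂ W n) := by
  refine subsingleton_of_forall_eq 0 fun e => ?_
  obtain ⟨e', rfl⟩ := Ext.contravariant_sequence_exact₂ hS W e (Subsingleton.elim _ _)
  rw [Subsingleton.elim e' 0, Ext.comp_zero]

theorem ext_subsingleton_X₃ (hS : S.ShortExact) {W : ModuleCat.{u} R} {n : ℕ}
    (h₁ : Subsingleton (Ext S.X₁ W n)) (h₂ : Subsingleton (Ext S.X₂ W (n + 1))) :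
    Subsingleton (Ext S.X₃ W (n + 1)) := by
  refine subsingleton_of_forall_eq 0 fun e => ?_
  obtain ⟨e', rfl⟩ := Ext.contravariant_sequence_exact₃ hS W e (Subsingleton.elim _ _)
    (add_comm 1 n)
  rw [Subsingleton.elim e' 0, Ext.comp_zero]

theorem ext_subsingleton_X₁ (hS : S.ShortExact) {W : ModuleCat.{u} R} {n : ℕ}
    (h₂ : Subsingleton (Ext S.X₂ W n)) (h₃ : Subsingleton (Ext S.X₃ W (n + 1))) :
    Subsingleton (Ext S.X₁ W n) := by
  refine subsingleton_of_forall_eq 0 fun e => ?_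
  obtain ⟨e', rfl⟩ := Ext.contravariant_sequence_exact₁ hS W e (add_comm 1 n)
    (Subsingleton.elim _ _)
  rw [Subsingleton.elim e' 0, Ext.comp_zero]

theorem ext_one_subsingleton_of_extension (hS : S.ShortExact) {W : ModuleCat.{u} R}
    (h₂ : Subsingleton (Ext S.X₂ W 1)) (h : ∀ f : S.X₁ ⟶ W, ∃ k : S.X₂ ⟶ W, S.f ≫ k = f) :
    Subsingleton (Ext S.X₃ W 1) := by
  refine subsingleton_of_forall_eq 0 fun e => ?_
  obtain ⟨e', rfl⟩ := Ext.contravariant_sequence_exact₃ hS W e (Subsingleton.elim _ _)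
    (add_zero 1)
  obtain ⟨f, rfl⟩ := (Ext.mk₀_bijective _ _).2 e'
  obtain ⟨k, rfl⟩ := h f
  rw [← Ext.mk₀_comp_mk₀]
  exact hS.extClass_comp_assoc _

theorem exists_extension_of_ext_one (hS : S.ShortExact) {W : ModuleCat.{u} R}
    (h₃ : Subsingleton (Ext S.X₃ W 1)) (f : S.X₁ ⟶ W) : ∃ k : S.X₂ ⟶ W, S.f ≫ k = f := by
  obtain ⟨e, he⟩ := Ext.contravariant_sequence_exact₁ hS W (Ext.mk₀ f) (add_zero 1)
    (Subsingleton.elim _ _)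
  obtain ⟨k, rfl⟩ := (Ext.mk₀_bijective _ _).2 e
  rw [Ext.mk₀_comp_mk₀] at he
  exact ⟨k, (Ext.mk₀_bijective _ _).1 he⟩

end Ext

/-! ### PGF-modules as the largest coresolved class -/

section Complexes

variable {R : Type u} [Ring R]

/-- The modules that the complexes in the definition of PGF-modules are tested against: the
projective ones and the character modules of the injective right modules. -/
def IsTest (W : ModuleCat.{u} R) : Prop :=
  Projective W ∨ ∃ I : ModuleCat.{u} Rᵐᵒᵖ, Injective I ∧ W = ModuleCat.of R (LeftDual I)

/-- A class of modules with vanishing `Ext` to all test modules, in which every module embeds into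
a projective module with cokernel in the class. -/
def IsCoresolvedClass (X : ModuleCat.{u} R → Prop) : Prop :=
  ∀ M, X M → (∀ W, IsTest W → ∀ n : ℕ, Subsingleton (Abelian.Ext M W (n + 1))) ∧
    ∃ (P N : ModuleCat.{u} R) (f : M ⟶ P) (g : P ⟶ N) (w : f ≫ g = 0),
      (ShortComplex.mk f g w).ShortExact ∧ Projective P ∧ X N

variable {C : CochainComplex (ModuleCat.{u} R) ℤ}

/-- Projective targets need the pure-resolution argument, applied to the half of the complex
starting in degree `i`; character modules need only duality. -/
theorem exists_extension_of_isTest (hP : ∀ i, Projective (C.X i))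
    (hC : ∀ I : ModuleCat.{u} Rᵐᵒᵖ, Injective I → ∀ i : ℤ,
      Function.Exact (Tensor.map I (C.d (i - 1) i)) (Tensor.map I (C.d i (i + 1))))
    {W : ModuleCat.{u} R} (hW : IsTest W) {i j k : ℤ} (hij : i + 1 = j) (hjk : j + 1 = k)
    (g : C.X j ⟶ W) (hg : C.d i j ≫ g = 0) : ∃ h : C.X k ⟶ W, C.d j k ≫ h = g := by
  have hC' : ∀ I : ModuleCat.{u} Rᵐᵒᵖ, Injective I → ∀ i j k : ℤ, i + 1 = j → j + 1 = k →
      Function.Exact (Tensor.map I (C.d i j)) (Tensor.map I (C.d j k)) := by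
    rintro I hI i j k hij rfl
    obtain rfl : i = j - 1 := by lia
    exact hC I hI j
  rcases hW with hW | ⟨I, hI, rfl⟩
  · obtain rfl : j = i + ((1 : ℕ) : ℤ) := by simp [hij]
    obtain rfl : k = i + ((2 : ℕ) : ℤ) := by rw [← hjk]; push_cast; ring
    have hPr : ∀ i, Module.Projective R (C.X i) := fun i =>
      (IsProjective.iff_projective (C.X i)).2 (hP i)
    have : Module.Projective R W := (IsProjective.iff_projective W).2 hW
    obtain ⟨h, hh⟩ := exists_extension_of_locallyExact (P := fun n : ℕ => C.X (i + n))
      (d := fun n => (C.d (i + n) (i + (n + 1 : ℕ))).hom)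
      (fun n => by rw [← ModuleCat.hom_comp, C.d_comp_d]; rfl) (N := W)
      (fun n => locallyExact_of_tensor_exact
        (fun I hI => hC' I hI _ _ _ (by push_cast; ring) (by push_cast; ring)) W)
      g.hom (by
        have h0 : ∀ l, l = i → C.d l (i + ((1 : ℕ) : ℤ)) ≫ g = 0 := by
          rintro _ rfl; exact hg
        exact congrArg ModuleCat.Hom.hom (h0 (i + ((0 : ℕ) : ℤ)) (by simp)))
    exact ⟨ModuleCat.ofHom h, ModuleCat.hom_ext hh⟩
  · obtain ⟨h, hh⟩ := hom_exact_of_tensor_exact (hC' I hI i j k hij hjk) g.hom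
      (congrArg ModuleCat.Hom.hom hg)
    exact ⟨ModuleCat.ofHom h, ModuleCat.hom_ext hh⟩

theorem iCycles_toCycles (C : CochainComplex (ModuleCat.{u} R) ℤ) (i j : ℤ) :
    C.iCycles i ≫ C.toCycles i j = 0 := by
  rw [← cancel_mono (C.iCycles j)]; simp

theorem _root_.CategoryTheory.ShortComplex.ShortExact.of_iso_left
    {S : ShortComplex (ModuleCat.{u} R)} (hS : S.ShortExact) {M : ModuleCat.{u} R} (e : M ≅ S.X₁) :
    (ShortComplex.mk (e.hom ≫ S.f) S.g (by simp)).ShortExact :=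
  ShortComplex.shortExact_of_iso (S₁ := S) (ShortComplex.isoMk e.symm (Iso.refl _) (Iso.refl _)
    (by simp) (by simp)) hS

theorem shortExact_cycles (hC : C.Acyclic) {i j : ℤ} (hij : i + 1 = j) :
    (ShortComplex.mk (C.iCycles i) (C.toCycles i j)
      (iCycles_toCycles C i j)).ShortExact := by
  have : Epi (C.toCycles i j) := by
    have hex := (C.exactAt_iff' i j (j + 1) (by simp [← hij]) (by simp)).1 (hC j)
    have := hex.epi_toCycles
    have e := (Iso.eq_comp_inv _).2
      (C.toCycles_cyclesIsoSc'_hom i j (j + 1) (by simp [← hij]) (by simp))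
    rw [e]
    exact epi_comp' this inferInstance
  exact
    { exact := ShortComplex.exact_of_f_is_kernel _
        (isKernelOfComp _ _ (C.cyclesIsKernel i j (by simp [hij])) _ (C.toCycles_i i j))
      mono_f := inferInstanceAs (Mono (C.iCycles i))
      epi_g := this }

theorem isCoresolvedClass_isPGF : IsCoresolvedClass (IsPGF (R := R)) := by
  rintro M ⟨C, hP, hC, ht, i, ⟨e⟩⟩
  have hS := shortExact_cycles hC (i := i) rfl
  refine ⟨fun W hW n => ?_, C.X i, C.cycles (i + 1), e.hom ≫ C.iCycles i, C.toCycles i (i + 1),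
    ?_, ?_, hP i, C, hP, hC, ht, i + 1, ⟨Iso.refl _⟩⟩
  · refine ext_subsingleton_of_retract e.hom e.inv e.hom_inv_id ?_
    have hp : ∀ i n, Subsingleton (Abelian.Ext (C.X i) W (n + 1)) := fun i n =>
      have := hP i
      Abelian.Ext.subsingleton_of_projective _ _ _
    clear hS e
    induction n generalizing i with
    | zero =>
      have hS := shortExact_cycles hC (i := i - 1) (j := i) (by ring)
      refine ext_one_subsingleton_of_extension hS (hp _ _) fun f => ?_
      have hS' := shortExact_cycles hC (i := i - 2) (j := i - 1) (by ring)
      -- A map from the cycles in degree `i - 1` becomes, on `C.X (i - 2)`, a map killing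
      -- boundaries. Its extension to `C.X (i - 1)` restricts to the given map because `toCycles` is
      -- epi.
      obtain ⟨h, hh⟩ := exists_extension_of_isTest hP ht hW (i := i - 3) (j := i - 2) (k := i - 1)
        (by ring) (by ring) (C.toCycles (i - 2) (i - 1) ≫ f) (by simp)
      refine ⟨h, ?_⟩
      have : Epi (C.toCycles (i - 2) (i - 1)) := hS'.epi_g
      rw [← cancel_epi (C.toCycles (i - 2) (i - 1)), ← hh]
      simp
    | succ n ih =>
      have hS := shortExact_cycles hC (i := i - 1) (j := i) (by ring)
      exact ext_subsingleton_X₃ hS (ih (i - 1)) (hp _ _)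
  · rw [Category.assoc, iCycles_toCycles C i (i + 1), comp_zero]
  · exact hS.of_iso_left e

theorem exists_bi_infinite_chain {α : Type*} (r : α → α → Prop) (h₁ : ∀ x, ∃ y, r x y)
    (h₂ : ∀ y, ∃ x, r x y) (a : α) : ∃ v : ℤ → α, v 0 = a ∧ ∀ i, r (v i) (v (i + 1)) := by
  choose s hs using h₁
  choose p hp using h₂
  let v : ℤ → α := fun i => match i with
    | Int.ofNat n => s^[n] a
    | Int.negSucc n => p^[n + 1] a
  refine ⟨v, rfl, fun i => ?_⟩
  match i with
  | Int.ofNat n =>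
    change r (s^[n] a) (s^[n + 1] a)
    rw [Function.iterate_succ_apply']
    exact hs _
  | Int.negSucc 0 => exact hp a
  | Int.negSucc (n + 1) =>
    change r (p^[n + 2] a) (p^[n + 1] a)
    rw [Function.iterate_succ_apply']
    exact hp _

/-- A bi-infinite chain of short exact sequences with projective middle terms whose other terms
have no `Ext¹` to test modules consists of PGF-modules. -/
theorem isPGF_of_chain (X P : ℤ → ModuleCat.{u} R) (f : ∀ i, X i ⟶ P i) (g : ∀ i, P i ⟶ X (i + 1))
    (w : ∀ i, f i ≫ g i = 0) (hS : ∀ i, (ShortComplex.mk (f i) (g i) (w i)).ShortExact)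
    (hP : ∀ i, Projective (P i))
    (hX : ∀ i W, IsTest W → Subsingleton (Abelian.Ext (X i) W 1)) : IsPGF (X 0) := by
  have hmono : ∀ i, Mono (f i) := fun i => (hS i).mono_f
  have hepi : ∀ i, Epi (g i) := fun i => (hS i).epi_g
  let C : CochainComplex (ModuleCat.{u} R) ℤ :=
    CochainComplex.of P (fun i => g i ≫ f (i + 1)) (fun i => by
      simp [reassoc_of% (w (i + 1))])
  have hd : ∀ i, C.d i (i + 1) = g i ≫ f (i + 1) := fun i => 
    CochainComplex.of_d P (fun i => g i ≫ f (i + 1)) i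
  refine ⟨C, hP, fun i => ?_, fun I hI i => ?_, 0, ⟨?_⟩⟩
  · obtain ⟨i, rfl⟩ : ∃ j, i = j + 1 := ⟨i - 1, by ring⟩
    rw [C.exactAt_iff' i (i + 1) (i + 1 + 1) (by simp) (by simp), ShortComplex.moduleCat_exact_iff]
    intro x hx
    change C.d (i + 1) (i + 1 + 1) x = 0 at hx
    change ∃ y, C.d i (i + 1) y = x
    rw [hd] at hx ⊢
    have hx' : g (i + 1) x = 0 := (ModuleCat.mono_iff_injective _).1 (hmono (i + 1 + 1))
      (hx.trans (map_zero _).symm)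
    obtain ⟨z, rfl⟩ := (ShortComplex.moduleCat_exact_iff _).1 (hS (i + 1)).exact x hx'
    obtain ⟨y, rfl⟩ := (ModuleCat.epi_iff_surjective _).1 (hepi i) z
    exact ⟨y, rfl⟩
  · obtain ⟨i, rfl⟩ : ∃ j, i = j + 1 := ⟨i - 1, by ring⟩
    have : ∀ l, l = i → Function.Exact (Tensor.map I (C.d l (i + 1)))
        (Tensor.map I (C.d (i + 1) (i + 1 + 1))) := by
      rintro l rfl
      refine tensor_exact_of_hom_exact (C.d_comp_d _ _ _) fun k hk => ?_
      have hk' : f (l + 1) ≫ ModuleCat.ofHom k = 0 := by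
        rw [← cancel_epi (g l), ← Category.assoc, ← hd, comp_zero]
        exact ModuleCat.hom_ext hk
      have := (hS (l + 1)).epi_g
      -- The map `k` descends to `X (l + 2)`, and `Ext¹` from `X (l + 3)` obstructs its extension to
      -- the next projective.
      obtain ⟨q, hq⟩ := exists_extension_of_ext_one (hS (l + 1 + 1))
        (hX _ _ (Or.inr ⟨I, hI, rfl⟩)) ((hS (l + 1)).exact.desc (ModuleCat.ofHom k) hk')
      refine ⟨q.hom, ?_⟩
      have : C.d (l + 1) (l + 1 + 1) ≫ q = ModuleCat.ofHom k := by
        rw [hd, Category.assoc]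
        refine (congrArg (fun t => g (l + 1) ≫ t) hq).trans ?_
        exact (hS (l + 1)).exact.g_desc (ModuleCat.ofHom k) hk'
      exact congrArg ModuleCat.Hom.hom this
    exact this _ (by ring)
  · exact IsLimit.conePointUniqueUpToIso
      (isKernelCompMono (hS 0).fIsKernel (f (0 + 1)) (hd 0))
      (C.cyclesIsKernel 0 1 (by simp))

/-- The PGF-modules form the largest coresolved class. -/
theorem IsCoresolvedClass.isPGF {X : ModuleCat.{u} R → Prop} (hX : IsCoresolvedClass X)
    {M : ModuleCat.{u} R} (hM : X M) : IsPGF M := by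
  let Y : ModuleCat.{u} R → Prop := fun N => ∃ Z, IsCoresolvedClass Z ∧ Z N
  have hY : IsCoresolvedClass Y := by
    rintro N ⟨Z, hZ, hN⟩
    obtain ⟨h, P, L, f, g, w, hS, hP, hL⟩ := hZ N hN
    exact ⟨h, P, L, f, g, w, hS, hP, Z, hZ, hL⟩
  let r : {N // Y N} → {N // Y N} → Prop := fun A B =>
    ∃ (P : ModuleCat.{u} R) (f : A.1 ⟶ P) (g : P ⟶ B.1) (w : f ≫ g = 0),
      (ShortComplex.mk f g w).ShortExact ∧ Projective P
  obtain ⟨v, hv0, hv⟩ := exists_bi_infinite_chain r (by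
    rintro ⟨N, hN⟩
    obtain ⟨-, P, L, f, g, w, hS, hP, hL⟩ := hY N hN
    exact ⟨⟨L, hL⟩, P, f, g, w, hS, hP⟩) (by
    rintro ⟨N, hN⟩
    have hS : (ShortComplex.mk (kernel.ι (Projective.π N)) (Projective.π N)
      (kernel.condition _)).ShortExact :=
        { exact := ShortComplex.exact_of_f_is_kernel _ (kernelIsKernel _) }
    -- To continue the chain to the left, adjoin the syzygy of `N` to `Y`: by dimension shifting it
    -- has no higher `Ext` to test modules, and its cokernel `N` lies in `Y`.
    refine ⟨⟨kernel (Projective.π N), fun A => A = kernel (Projective.π N) ∨ Y A, ?_, Or.inl rfl⟩,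
      Projective.over N, kernel.ι _, Projective.π N, kernel.condition _, hS, inferInstance⟩
    rintro A (rfl | hA)
    · exact ⟨fun W hW n => ext_subsingleton_X₁ hS
        (Abelian.Ext.subsingleton_of_projective _ _ _) ((hY N hN).1 W hW (n + 1)),
        _, N, _, _, _, hS, inferInstance, Or.inr hN⟩
    · obtain ⟨h, P, L, f, g, w, hS, hP, hL⟩ := hY A hA
      exact ⟨h, P, L, f, g, w, hS, hP, Or.inr hL⟩) ⟨M, X, hX, hM⟩
  choose P f g w hS hP using hv
  have := isPGF_of_chain (fun i => (v i).1) P f g w hS hP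
    fun i W hW => (hY _ (v i).2).1 W hW 0
  rwa [hv0] at this

end Complexes

/-! ### Pushouts, pullbacks and composites of short exact sequences -/

section ShortExactSequences

variable {R : Type u} [Ring R] {A B C D E U V X Y Z : ModuleCat.{u} R}

/-- There is a short exact sequence `0 ⟶ A ⟶ B ⟶ C ⟶ 0`. -/
def SES (A B C : ModuleCat.{u} R) : Prop :=
  ∃ (f : A ⟶ B) (g : B ⟶ C) (w : f ≫ g = 0), (ShortComplex.mk f g w).ShortExact

theorem SES.of_linear (f : A →ₗ[R] B) (g : B →ₗ[R] C) (hf : Function.Injective f)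
    (hfg : Function.Exact f g) (hg : Function.Surjective g) : SES A B C :=
  ⟨ModuleCat.ofHom f, ModuleCat.ofHom g,
    ModuleCat.hom_ext (LinearMap.ext fun x => hfg.apply_apply_eq_zero x),
    { exact := (ShortComplex.moduleCat_exact_iff _).2 fun x hx => (hfg x).1 hx
      mono_f := (ModuleCat.mono_iff_injective _).2 hf
      epi_g := (ModuleCat.epi_iff_surjective _).2 hg }⟩

theorem SES.exists_linear (h : SES A B C) : ∃ (f : A →ₗ[R] B) (g : B →ₗ[R] C),
    Function.Injective f ∧ Function.Exact f g ∧ Function.Surjective g := by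
  obtain ⟨f, g, w, h⟩ := h
  refine ⟨f.hom, g.hom, (ModuleCat.mono_iff_injective _).1 h.mono_f, fun x =>
    ⟨(ShortComplex.moduleCat_exact_iff _).1 h.exact x, ?_⟩,
    (ModuleCat.epi_iff_surjective _).1 h.epi_g⟩
  rintro ⟨y, rfl⟩
  exact congrArg (fun k => k.hom y) w

theorem SES.of_iso_left (h : SES A B C) (e : D ≅ A) : SES D B C := by
  obtain ⟨f, g, w, h⟩ := h
  exact ⟨_, _, _, h.of_iso_left e⟩

theorem SES.of_iso_right (h : SES A B C) (e : C ≅ D) : SES A B D := by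
  obtain ⟨f, g, w, h⟩ := h
  exact ⟨f, g ≫ e.hom, by simp [reassoc_of% w], ShortComplex.shortExact_of_iso
    (S₁ := ShortComplex.mk f g w)
    (ShortComplex.isoMk (Iso.refl _) (Iso.refl _) e (by simp) (by simp)) h⟩

theorem SES.pushout (h₁ : SES A B C) (h₂ : SES A D E) : ∃ Z, SES D Z C ∧ SES B Z E := by
  obtain ⟨f, g, hf, hfg, hg⟩ := h₁.exists_linear
  obtain ⟨i, p, hi, hip, hp⟩ := h₂.exists_linear
  let N := LinearMap.range (f.prod (-i))
  have hN : ∀ b d, (b, d) ∈ N ↔ ∃ a, f a = b ∧ -i a = d := fun b d => by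
    simp [N, LinearMap.mem_range, Prod.ext_iff]
  refine ⟨ModuleCat.of R ((B × D) ⧸ N),
    SES.of_linear (N.mkQ ∘ₗ LinearMap.inr R B D)
      (N.liftQ (g ∘ₗ LinearMap.fst R B D) ?_) ?_ ?_ ?_,
    SES.of_linear (N.mkQ ∘ₗ LinearMap.inl R B D)
      (N.liftQ (p ∘ₗ LinearMap.snd R B D) ?_) ?_ ?_ ?_⟩
  · rintro _ ⟨a, rfl⟩
    simpa using hfg.apply_apply_eq_zero a
  · refine (injective_iff_map_eq_zero _).2 fun d hd => ?_
    obtain ⟨a, ha, rfl⟩ := (hN 0 d).1 ((Submodule.Quotient.mk_eq_zero N).1 hd)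
    rw [(map_eq_zero_iff f hf).1 ha]; simp
  · intro z
    obtain ⟨⟨b, d⟩, rfl⟩ := N.mkQ_surjective z
    constructor
    · intro hz
      obtain ⟨a, rfl⟩ := (hfg b).1 hz
      exact ⟨d + i a, (Submodule.Quotient.eq N).2 ((hN _ _).2 ⟨-a, by simp, by simp⟩)⟩
    · rintro ⟨d', hd'⟩
      rw [← hd']
      exact map_zero g
  · intro c
    obtain ⟨b, rfl⟩ := hg c
    exact ⟨N.mkQ (b, 0), rfl⟩
  · rintro _ ⟨a, rfl⟩
    simpa using hip.apply_apply_eq_zero a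
  · refine (injective_iff_map_eq_zero _).2 fun b hb => ?_
    obtain ⟨a, rfl, ha⟩ := (hN b 0).1 ((Submodule.Quotient.mk_eq_zero N).1 hb)
    rw [(map_eq_zero_iff i hi).1 (neg_eq_zero.1 ha)]; simp
  · intro z
    obtain ⟨⟨b, d⟩, rfl⟩ := N.mkQ_surjective z
    constructor
    · intro hz
      obtain ⟨a, rfl⟩ := (hip d).1 hz
      exact ⟨b + f a, (Submodule.Quotient.eq N).2 ((hN _ _).2 ⟨a, by simp, by simp⟩)⟩
    · rintro ⟨b', hb'⟩
      rw [← hb']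
      exact map_zero p
  · intro e
    obtain ⟨d, rfl⟩ := hp e
    exact ⟨N.mkQ (0, d), rfl⟩

theorem SES.pullback (h₁ : SES A B C) (h₂ : SES E D C) : ∃ Z, SES A Z D ∧ SES E Z B := by
  obtain ⟨f, g, hf, hfg, hg⟩ := h₁.exists_linear
  obtain ⟨i, p, hi, hip, hp⟩ := h₂.exists_linear
  let N := LinearMap.eqLocus (g ∘ₗ LinearMap.fst R B D) (p ∘ₗ LinearMap.snd R B D)
  refine ⟨ModuleCat.of R N,
    SES.of_linear ((LinearMap.inl R B D ∘ₗ f).codRestrict N fun a => ?_)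
      (LinearMap.snd R B D ∘ₗ N.subtype) ?_ ?_ ?_,
    SES.of_linear ((LinearMap.inr R B D ∘ₗ i).codRestrict N fun a => ?_)
      (LinearMap.fst R B D ∘ₗ N.subtype) ?_ ?_ ?_⟩
  · change g (f a) = p 0
    rw [hfg.apply_apply_eq_zero, map_zero]
  · intro a a' h
    exact hf (congrArg (fun x : N => x.1.1) h)
  · rintro ⟨⟨b, d⟩, hx⟩
    constructor
    · rintro (rfl : d = 0)
      obtain ⟨a, rfl⟩ := (hfg b).1 ((show g b = p 0 from hx).trans (map_zero p))
      exact ⟨a, rfl⟩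
    · rintro ⟨a, ha⟩
      exact (congrArg (fun x : N => x.1.2) ha).symm
  · intro d
    obtain ⟨b, hb⟩ := hg (p d)
    exact ⟨⟨(b, d), hb⟩, rfl⟩
  · change g 0 = p (i a)
    rw [hip.apply_apply_eq_zero, map_zero]
  · intro a a' h
    exact hi (congrArg (fun x : N => x.1.2) h)
  · rintro ⟨⟨b, d⟩, hx⟩
    constructor
    · rintro (rfl : b = 0)
      obtain ⟨a, rfl⟩ := (hip d).1 ((show g 0 = p d from hx).symm.trans (map_zero g))
      exact ⟨a, rfl⟩
    · rintro ⟨a, ha⟩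
      exact (congrArg (fun x : N => x.1.1) ha).symm
  · intro b
    obtain ⟨d, hd⟩ := hp (g b)
    exact ⟨⟨(b, d), hd.symm⟩, rfl⟩

/-- The kernel of a composition of epimorphisms. -/
theorem SES.comp_epi (h₁ : SES A B C) (h₂ : SES E C D) : ∃ Z, SES Z B D ∧ SES A Z E := by
  obtain ⟨f, g, hf, hfg, hg⟩ := h₁.exists_linear
  obtain ⟨i, p, hi, hip, hp⟩ := h₂.exists_linear
  let N := LinearMap.ker (p ∘ₗ g)
  have hN : ∀ x : N, ∃ e, i e = g x := fun x => (hip _).1 x.2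
  let e := LinearEquiv.ofInjective i hi
  let q : N →ₗ[R] E := e.symm.toLinearMap ∘ₗ
    (g ∘ₗ N.subtype).codRestrict (LinearMap.range i) hN
  have hq : ∀ x, i (q x) = g x := fun x =>
    congrArg Subtype.val (e.apply_symm_apply ⟨g x.1, hN x⟩)
  refine ⟨ModuleCat.of R N, SES.of_linear N.subtype (p ∘ₗ g) Subtype.val_injective ?_
    (hp.comp hg), SES.of_linear (f.codRestrict N fun a => ?_) q ?_ ?_ ?_⟩
  · intro x
    exact ⟨fun h => ⟨⟨x, h⟩, rfl⟩, by rintro ⟨y, rfl⟩; exact y.2⟩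
  · change p (g (f a)) = 0
    rw [hfg.apply_apply_eq_zero, map_zero]
  · intro a a' h
    exact hf (congrArg Subtype.val h)
  · intro x
    rw [← map_eq_zero_iff i hi, hq, hfg]
    exact ⟨fun ⟨a, ha⟩ => ⟨a, Subtype.ext ha⟩, fun ⟨a, ha⟩ => ⟨a, congrArg Subtype.val ha⟩⟩
  · intro y
    obtain ⟨b, hb⟩ := hg (i y)
    exact ⟨⟨b, by change p (g b) = 0; rw [hb, hip.apply_apply_eq_zero]⟩,
      hi ((hq _).trans hb)⟩

/-- The cokernel of a composition of monomorphisms. -/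
theorem SES.comp_mono (h₁ : SES X Y U) (h₂ : SES Y Z V) : ∃ W, SES X Z W ∧ SES U W V := by
  obtain ⟨f, g, hf, hfg, hg⟩ := h₁.exists_linear
  obtain ⟨i, p, hi, hip, hp⟩ := h₂.exists_linear
  let N := LinearMap.range (i ∘ₗ f)
  have hN : N ≤ LinearMap.ker p := by
    rintro _ ⟨x, rfl⟩
    exact hip.apply_apply_eq_zero (f x)
  have hk : LinearMap.ker g ≤ LinearMap.ker (N.mkQ ∘ₗ i) := by
    intro y hy
    obtain ⟨x, rfl⟩ := (hfg y).1 hy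
    exact (Submodule.Quotient.mk_eq_zero N).2 ⟨x, rfl⟩
  let e := g.quotKerEquivOfSurjective hg
  let j : U →ₗ[R] Z ⧸ N := (LinearMap.ker g).liftQ (N.mkQ ∘ₗ i) hk ∘ₗ e.symm.toLinearMap
  have hj : ∀ y, j (g y) = N.mkQ (i y) := fun y => by
    have : e.symm (g y) = (LinearMap.ker g).mkQ y := e.symm_apply_eq.2 rfl
    simp only [j, LinearMap.comp_apply, LinearEquiv.coe_coe, this]
    rfl
  refine ⟨ModuleCat.of R (Z ⧸ N), SES.of_linear (i ∘ₗ f) N.mkQ (hi.comp hf) (fun x => ?_)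
    N.mkQ_surjective, SES.of_linear j (N.liftQ p hN) ?_ ?_ ?_⟩
  · exact Submodule.Quotient.mk_eq_zero N
  · refine (injective_iff_map_eq_zero _).2 fun x hx => ?_
    obtain ⟨y, rfl⟩ := hg x
    rw [hj] at hx
    obtain ⟨x, hx⟩ := (Submodule.Quotient.mk_eq_zero N).1 hx
    rw [← hi hx]
    exact hfg.apply_apply_eq_zero x
  · intro w
    obtain ⟨z, rfl⟩ := N.mkQ_surjective w
    constructor
    · intro hz
      obtain ⟨y, rfl⟩ := (hip z).1 hz
      exact ⟨g y, hj y⟩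
    · rintro ⟨x, hx⟩
      obtain ⟨y, rfl⟩ := hg x
      rw [← hx, hj]
      exact hip.apply_apply_eq_zero y
  · intro v
    obtain ⟨z, rfl⟩ := hp v
    exact ⟨N.mkQ z, rfl⟩

theorem SES.prod_left (h : SES A B C) (P : ModuleCat.{u} R) :
    SES (ModuleCat.of R (P × A)) (ModuleCat.of R (P × B)) C := by
  obtain ⟨f, g, hf, hfg, hg⟩ := h.exists_linear
  refine SES.of_linear (LinearMap.id.prodMap f) (g ∘ₗ LinearMap.snd R P B)
    (Function.injective_id.prodMap hf) ?_ (hg.comp Prod.snd_surjective)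
  rintro ⟨p, b⟩
  refine (hfg b).trans ⟨?_, ?_⟩
  · rintro ⟨a, rfl⟩; exact ⟨(p, a), rfl⟩
  · rintro ⟨⟨q, a⟩, h⟩; exact ⟨a, congrArg Prod.snd h⟩

theorem SES.prod_right (h : SES A B C) (P : ModuleCat.{u} R) :
    SES A (ModuleCat.of R (B × P)) (ModuleCat.of R (C × P)) := by
  obtain ⟨f, g, hf, hfg, hg⟩ := h.exists_linear
  refine SES.of_linear (LinearMap.inl R B P ∘ₗ f) (g.prodMap LinearMap.id)
    (LinearMap.inl_injective.comp hf) ?_ (hg.prodMap Function.surjective_id)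
  rintro ⟨b, p⟩
  constructor
  · intro h
    obtain ⟨a, rfl⟩ := (hfg b).1 (congrArg Prod.fst h)
    exact ⟨a, Prod.ext rfl (congrArg Prod.snd h).symm⟩
  · rintro ⟨a, h⟩
    rw [← h]
    exact Prod.ext (hfg.apply_apply_eq_zero a) rfl

theorem SES.of_prod (A B : ModuleCat.{u} R) : SES A (ModuleCat.of R (A × B)) B :=
  SES.of_linear (LinearMap.inl R A B) (LinearMap.snd R A B) LinearMap.inl_injective
    (fun x => by
      constructor
      · intro h
        exact ⟨x.1, Prod.ext rfl h.symm⟩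
      · rintro ⟨a, rfl⟩; rfl) LinearMap.snd_surjective

/-- A short exact sequence splits if the relevant `Ext¹` vanishes. -/
theorem SES.retract (h : SES A B C) (hAC : Subsingleton (Abelian.Ext C A 1)) :
    Nonempty (Retract A B) := by
  obtain ⟨f, g, w, h⟩ := h
  obtain ⟨k, hk⟩ := exists_extension_of_ext_one h hAC (𝟙 A)
  exact ⟨⟨f, k, hk⟩⟩

theorem SES.iso_prod (h : SES A B C) (hAC : Subsingleton (Abelian.Ext C A 1)) :
    Nonempty (B ≅ ModuleCat.of R (A × C)) := by
  obtain ⟨f, g, w, h⟩ := h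
  obtain ⟨k, hk⟩ := exists_extension_of_ext_one h hAC (𝟙 A)
  have hk' : ∀ a, k.hom (f.hom a) = a := fun a => congrArg (fun q => q.hom a) hk
  have hw : ∀ a, g.hom (f.hom a) = 0 := fun a => congrArg (fun q => q.hom a) w
  refine ⟨(LinearEquiv.ofBijective (k.hom.prod g.hom) ⟨?_, ?_⟩).toModuleIso⟩
  · refine (injective_iff_map_eq_zero _).2 fun b hb => ?_
    obtain ⟨a, rfl⟩ := (ShortComplex.moduleCat_exact_iff _).1 h.exact b (congrArg Prod.snd hb)
    have : k.hom (f.hom a) = 0 := congrArg Prod.fst hb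
    rw [hk'] at this
    rw [this]
    exact map_zero f.hom
  · rintro ⟨a, c⟩
    obtain ⟨b, rfl⟩ := (ModuleCat.epi_iff_surjective _).1 h.epi_g c
    refine ⟨b + f.hom (a - k.hom b), Prod.ext ?_ ?_⟩
    · change k.hom _ = a
      rw [map_add, hk']; abel
    · change g.hom _ = g.hom b
      rw [map_add, hw, add_zero]

theorem exists_projective_presentation (M : ModuleCat.{u} R) :
    ∃ K P : ModuleCat.{u} R, Projective P ∧ SES K P M :=
  ⟨kernel (Projective.π M), Projective.over M, inferInstance, kernel.ι _, Projective.π M,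
    kernel.condition _, { exact := ShortComplex.exact_of_f_is_kernel _ (kernelIsKernel _) }⟩

end ShortExactSequences

/-! ### Closure properties of PGF-modules -/

section Closure

variable {R : Type u} [Ring R] {A B C M N P : ModuleCat.{u} R}

theorem IsPGF.of_iso (h : IsPGF M) (e : N ≅ M) : IsPGF N := by
  obtain ⟨C, hP, hC, ht, i, ⟨e'⟩⟩ := h
  exact ⟨C, hP, hC, ht, i, ⟨e ≪≫ e'⟩⟩

theorem IsPGF.ext_subsingleton (h : IsPGF M) {W : ModuleCat.{u} R} (hW : IsTest W) (n : ℕ) :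
    Subsingleton (Abelian.Ext M W (n + 1)) :=
  (isCoresolvedClass_isPGF M h).1 W hW n

theorem IsPGF.exists_coresolution (h : IsPGF M) :
    ∃ P N : ModuleCat.{u} R, Projective P ∧ IsPGF N ∧ SES M P N := by
  obtain ⟨-, P, N, f, g, w, hS, hP, hN⟩ := isCoresolvedClass_isPGF M h
  exact ⟨P, N, hP, hN, f, g, w, hS⟩

/-- To see that a module is a PGF-module it suffices to have one step of a coresolution. -/
theorem isPGF_of_coresolution (hM : ∀ W, IsTest W → ∀ n : ℕ,
    Subsingleton (Abelian.Ext M W (n + 1))) (hP : Projective P) (hN : IsPGF N) (h : SES M P N) :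
    IsPGF M := by
  obtain ⟨f, g, w, h⟩ := h
  refine IsCoresolvedClass.isPGF (X := fun K => K = M ∨ IsPGF K) ?_ (Or.inl rfl)
  rintro K (rfl | hK)
  · exact ⟨hM, P, N, f, g, w, h, hP, Or.inr hN⟩
  · obtain ⟨h, P, L, f, g, w, hS, hP, hL⟩ := isCoresolvedClass_isPGF K hK
    exact ⟨h, P, L, f, g, w, hS, hP, Or.inr hL⟩

theorem isPGF_of_projective (hP : Projective P) : IsPGF P := by
  refine IsCoresolvedClass.isPGF (X := fun K => Projective K) (fun K hK => ?_) hP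
  obtain ⟨f, g, w, h⟩ : SES K K (ModuleCat.of R PUnit) :=
    SES.of_linear LinearMap.id 0 Function.injective_id (fun x => by simp) fun _ => ⟨0, rfl⟩
  exact ⟨fun W _ n => Abelian.Ext.subsingleton_of_projective _ _ _, K, _, f, g, w, h, hK,
    (IsProjective.iff_projective _).1 inferInstance⟩

theorem projective_prod {P Q : ModuleCat.{u} R} (hP : Projective P) (hQ : Projective Q) :
    Projective (ModuleCat.of R (P × Q)) := by
  have := (IsProjective.iff_projective P).2 hP
  have := (IsProjective.iff_projective Q).2 hQ
  exact (IsProjective.iff_projective _).1 inferInstance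

/-- The PGF-modules are closed under extensions. -/
theorem IsPGF.of_extension (h : SES A B C) (hA : IsPGF A) (hC : IsPGF C) : IsPGF B := by
  refine IsCoresolvedClass.isPGF (X := fun B => ∃ A C, SES A B C ∧ IsPGF A ∧ IsPGF C) ?_
    ⟨A, C, h, hA, hC⟩
  rintro B ⟨A, C, h, hA, hC⟩
  constructor
  · intro W hW n
    obtain ⟨f, g, w, h⟩ := h
    exact ext_subsingleton_X₂ h (hA.ext_subsingleton hW n) (hC.ext_subsingleton hW n)
  · obtain ⟨P, A', hP, hA', hPA⟩ := hA.exists_coresolution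
    obtain ⟨Q, C', hQ, hC', hQC⟩ := hC.exists_coresolution
    obtain ⟨Z, hZC, hBZ⟩ := h.pushout hPA
    -- This is the horseshoe lemma for coresolutions: the pushout along `A → P` splits since `Ext¹`
    -- from `C` to the projective `P` vanishes, so `B` embeds into `P × C` and then into `P × Q`.
    obtain ⟨e⟩ := hZC.iso_prod (hC.ext_subsingleton (Or.inl hP) 0)
    obtain ⟨W, ⟨f, g, w, hS⟩, hW⟩ := hBZ.comp_mono ((hQC.prod_left P).of_iso_left e)
    exact ⟨_, W, f, g, w, hS, projective_prod hP hQ, A', C', hW, hA', hC'⟩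

/-- The PGF-modules are closed under kernels of epimorphisms. -/
theorem IsPGF.of_kernel (h : SES A B C) (hB : IsPGF B) (hC : IsPGF C) : IsPGF A := by
  -- The case of a projective quotient; pulling back along a projective presentation of `C` reduces
  -- the general case to it.
  have key : ∀ {X P : ModuleCat.{u} R}, Projective P → IsPGF X → SES A X P → IsPGF A := by
    intro X P hP hX h
    obtain ⟨Q, Y, hQ, hY, hXQ⟩ := hX.exists_coresolution
    obtain ⟨W, hAW, hW⟩ := h.comp_mono hXQ
    refine isPGF_of_coresolution (fun T hT n => ?_) hQ
      (IsPGF.of_extension hW (isPGF_of_projective hP) hY) hAW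
    obtain ⟨f, g, w, h⟩ := h
    exact ext_subsingleton_X₁ h (hX.ext_subsingleton hT n)
      (Abelian.Ext.subsingleton_of_projective _ _ _)
  obtain ⟨K, P, hP, hK⟩ := exists_projective_presentation C
  obtain ⟨X, hAX, hKX⟩ := h.pullback hK
  have hK' : IsPGF K := by
    refine isPGF_of_coresolution (fun W hW n => ?_) hP hC hK
    obtain ⟨f, g, w, h⟩ := hK
    exact ext_subsingleton_X₁ h (Abelian.Ext.subsingleton_of_projective _ _ _)
      (hC.ext_subsingleton hW (n + 1))
  exact key hP (IsPGF.of_extension hKX hK' hB) hAX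

end Closure

/-! ### PGF-resolutions and projective dimension -/

section Dimensions

variable {R : Type u} [Ring R] {A B C G K L M N P : ModuleCat.{u} R}

theorem hasResolution_zero_iff : HasResolution 0 M ↔ IsPGF M :=
  ⟨fun ⟨_, hG, ⟨e⟩⟩ => hG.of_iso e.symm, fun h => ⟨M, h, ⟨Iso.refl _⟩⟩⟩

theorem hasResolution_succ_iff {n : ℕ} :
    HasResolution (n + 1) M ↔ ∃ L G, SES L G M ∧ IsPGF G ∧ HasResolution n L :=
  ⟨fun ⟨L, G, f, g, w, h, hG, hL⟩ => ⟨L, G, ⟨f, g, w, h⟩, hG, hL⟩,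
    fun ⟨L, G, ⟨f, g, w, h⟩, hG, hL⟩ => ⟨L, G, f, g, w, h, hG, hL⟩⟩

theorem HasResolution.of_iso {n : ℕ} (h : HasResolution n M) (e : M ≅ N) : HasResolution n N := by
  cases n with
  | zero => exact hasResolution_zero_iff.2 ((hasResolution_zero_iff.1 h).of_iso e.symm)
  | succ n =>
    obtain ⟨L, G, hS, hG, hL⟩ := hasResolution_succ_iff.1 h
    exact hasResolution_succ_iff.2 ⟨L, G, hS.of_iso_right e, hG, hL⟩

theorem dim_eq_iff {n : ℕ} :
    dim M = n ↔ HasResolution n M ∧ ∀ k < n, ¬ HasResolution k M := by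
  have hle : ∀ {k}, HasResolution k M → dim M ≤ k := fun {k} h => iInf₂_le k h
  have hge : ∀ {k : ℕ}, (∀ j < k, ¬ HasResolution j M) → (k : ℕ∞) ≤ dim M := fun {k} h =>
    le_iInf₂ fun j hj => by
      by_contra hlt
      exact h j (by exact_mod_cast not_le.1 hlt) hj
  constructor
  · intro h
    have hlt : ∀ k < n, ¬ HasResolution k M := fun k hk hr => by
      have := hle hr
      rw [h] at this
      exact absurd (by exact_mod_cast this : n ≤ k) (not_le.2 hk)
    refine ⟨by_contra fun hn => ?_, hlt⟩
    have := hge (k := n + 1) fun j hj => by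
      rcases (Nat.lt_succ_iff_lt_or_eq).1 hj with hj | rfl
      · exact hlt j hj
      · exact hn
    rw [h] at this
    exact absurd (by exact_mod_cast this : n + 1 ≤ n) (by lia)
  · rintro ⟨h, hlt⟩
    exact le_antisymm (hle h) (hge hlt)

theorem pd_le_iff {n : ℕ} : pd K ≤ n ↔ HasProjectiveDimensionLE K n := by
  rw [pd, WithBot.unbotD_le_iff fun _ => zero_le]
  exact projectiveDimension_le_iff K n

theorem hasProjectiveDimensionLE_of_pd_eq {n : ℕ} (h : pd K = n) :
    HasProjectiveDimensionLE K n := pd_le_iff.1 h.le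

theorem le_of_pd_eq {n k : ℕ} (h : pd K = n) (hk : HasProjectiveDimensionLE K k) : n ≤ k := by
  have := pd_le_iff.2 hk
  rw [h] at this
  exact_mod_cast this

theorem pd_eq {n : ℕ} (h : HasProjectiveDimensionLE K n)
    (hlt : ∀ k < n, ¬ HasProjectiveDimensionLE K k) : pd K = n := by
  refine le_antisymm (pd_le_iff.2 h) (not_lt.1 fun hk => ?_)
  obtain ⟨k, hk'⟩ := ENat.ne_top_iff_exists.1 (ne_top_of_lt hk)
  rw [← hk'] at hk
  exact hlt k (by exact_mod_cast hk) (pd_le_iff.1 hk'.symm.le)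

theorem SES.hasProjectiveDimensionLE_kernel (h : SES A B C) (hB : Projective B) {n : ℕ}
    (hC : HasProjectiveDimensionLE C (n + 1)) : HasProjectiveDimensionLE A n := by
  obtain ⟨f, g, w, h⟩ := h
  exact (h.hasProjectiveDimensionLT_X₃_iff n hB).1 hC

theorem SES.hasProjectiveDimensionLE_cokernel (h : SES A B C) (hB : Projective B) {n : ℕ}
    (hA : HasProjectiveDimensionLE A n) : HasProjectiveDimensionLE C (n + 1) := by
  obtain ⟨f, g, w, h⟩ := h
  exact (h.hasProjectiveDimensionLT_X₃_iff n hB).2 hA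

theorem hasResolution_of_hasProjectiveDimensionLE {n : ℕ} (h : HasProjectiveDimensionLE K n) :
    HasResolution n K := by
  induction n generalizing K with
  | zero =>
    exact hasResolution_zero_iff.2
      (isPGF_of_projective ((projective_iff_hasProjectiveDimensionLE_zero _).2 h))
  | succ n ih =>
    obtain ⟨L, P, hP, hS⟩ := exists_projective_presentation K
    exact hasResolution_succ_iff.2
      ⟨L, P, hS, isPGF_of_projective hP, ih (hS.hasProjectiveDimensionLE_kernel hP h)⟩

/-- PGF-modules have no extensions by modules of finite projective dimension. -/
theorem IsPGF.ext_subsingleton_of_hasProjectiveDimensionLE (hG : IsPGF G) {m : ℕ}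
    (h : HasProjectiveDimensionLE K m) (n : ℕ) : Subsingleton (Abelian.Ext G K (n + 1)) := by
  induction m generalizing K n with
  | zero =>
    exact hG.ext_subsingleton (Or.inl ((projective_iff_hasProjectiveDimensionLE_zero _).2 h)) n
  | succ m ih =>
    obtain ⟨L, P, hP, hS⟩ := exists_projective_presentation K
    have hL := ih (hS.hasProjectiveDimensionLE_kernel hP h) (n + 1)
    have hP' := hG.ext_subsingleton (Or.inl hP) n
    obtain ⟨f, g, w, hS⟩ := hS
    refine subsingleton_of_forall_eq 0 fun e => ?_
    obtain ⟨e', rfl⟩ := Abelian.Ext.covariant_sequence_exact₃ G hS e rfl (Subsingleton.elim _ _)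
    rw [Subsingleton.elim e' 0, Abelian.Ext.zero_comp]

/-- Pushing out along `L → K` replaces the kernel `L` by `K`, while the middle term becomes an
extension of `N` by `G`. -/
theorem SES.exists_special_precover (h : SES L G M) (hG : IsPGF G)
    {n : ℕ} (hL : ∃ K N, SES L K N ∧ HasProjectiveDimensionLE K n ∧ IsPGF N) :
    ∃ K Z, SES K Z M ∧ HasProjectiveDimensionLE K n ∧ IsPGF Z := by
  obtain ⟨K, N, hS, hK, hN⟩ := hL
  obtain ⟨Z, hKZ, hGZ⟩ := h.pushout hS
  exact ⟨K, Z, hKZ, hK, IsPGF.of_extension hGZ hG hN⟩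

/-- A module with a PGF-resolution of length `n` embeds into a module of projective dimension at
most `n` with a PGF-module as cokernel. -/
theorem HasResolution.exists_embedding {n : ℕ} (h : HasResolution n M) :
    ∃ K G, SES M K G ∧ HasProjectiveDimensionLE K n ∧ IsPGF G := by
  induction n generalizing M with
  | zero =>
    obtain ⟨P, N, hP, hN, hS⟩ := (hasResolution_zero_iff.1 h).exists_coresolution
    exact ⟨P, N, hS, (projective_iff_hasProjectiveDimensionLE_zero _).1 hP, hN⟩
  | succ n ih =>
    obtain ⟨L, G, hS, hG, hL⟩ := hasResolution_succ_iff.1 h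
    obtain ⟨K, Z, hKZ, hK, hZ⟩ := hS.exists_special_precover hG (ih hL)
    obtain ⟨P, N, hP, hN, hZP⟩ := hZ.exists_coresolution
    obtain ⟨W, hKW, hMW⟩ := hKZ.comp_mono hZP
    exact ⟨W, N, hMW, hKW.hasProjectiveDimensionLE_cokernel hP hK, hN⟩

/-- A module with a PGF-resolution of length `n + 1` has a PGF-module as special precover, with
kernel of projective dimension at most `n`. -/
theorem HasResolution.exists_precover {n : ℕ} (h : HasResolution (n + 1) M) :
    ∃ K G, SES K G M ∧ HasProjectiveDimensionLE K n ∧ IsPGF G := by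
  obtain ⟨L, G, hS, hG, hL⟩ := hasResolution_succ_iff.1 h
  exact hS.exists_special_precover hG hL.exists_embedding

/-- The embedding of `K` into a module of projective dimension at most `n` has PGF cokernel, so
finiteness of the projective dimension of `K` makes it split. The size of `m` is irrelevant. -/
theorem HasResolution.hasProjectiveDimensionLE {n m : ℕ} (h : HasResolution n K)
    (hK : HasProjectiveDimensionLE K m) : HasProjectiveDimensionLE K n := by
  obtain ⟨K', G, hS, hK', hG⟩ := h.exists_embedding
  obtain ⟨r⟩ := hS.retract (hG.ext_subsingleton_of_hasProjectiveDimensionLE hK 0)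
  have : HasProjectiveDimensionLT K' (n + 1) := hK'
  exact r.hasProjectiveDimensionLT (n + 1)

theorem HasResolution.of_kernel {n : ℕ} (h : SES A B C) (hB : HasResolution n B) (hC : IsPGF C) :
    HasResolution n A := by
  cases n with
  | zero =>
    rw [hasResolution_zero_iff] at hB ⊢
    exact IsPGF.of_kernel h hB hC
  | succ n =>
    obtain ⟨L, G, hS, hG, hL⟩ := hasResolution_succ_iff.1 hB
    obtain ⟨W, hWG, hLW⟩ := hS.comp_epi h
    exact hasResolution_succ_iff.2 ⟨L, W, hLW, IsPGF.of_kernel hWG hG hC, hL⟩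

theorem HasResolution.prod {n : ℕ} (hA : HasResolution n A) (hC : IsPGF C) :
    HasResolution n (ModuleCat.of R (A × C)) := by
  cases n with
  | zero =>
    rw [hasResolution_zero_iff] at hA ⊢
    exact IsPGF.of_extension (SES.of_prod A C) hA hC
  | succ n =>
    obtain ⟨L, G, hS, hG, hL⟩ := hasResolution_succ_iff.1 hA
    exact hasResolution_succ_iff.2 ⟨L, _, hS.prod_right C,
      IsPGF.of_extension (SES.of_prod G C) hG hC, hL⟩

/-- After `A` is pushed out into a module `K` of finite projective dimension, the extension by `C`
splits. Thus `B` is the kernel of an epimorphism from `K × C` to a PGF-module. -/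
theorem HasResolution.of_extension {n : ℕ} (h : SES A B C) (hA : HasResolution n A)
    (hC : IsPGF C) : HasResolution n B := by
  obtain ⟨K, G, hS, hK, hG⟩ := hA.exists_embedding
  obtain ⟨Z, hKZ, hBZ⟩ := h.pushout hS
  obtain ⟨e⟩ := hKZ.iso_prod (hC.ext_subsingleton_of_hasProjectiveDimensionLE hK 0)
  exact HasResolution.of_kernel hBZ
    (((hasResolution_of_hasProjectiveDimensionLE hK).prod hC).of_iso e.symm) hG

/-- Kernels of epimorphisms from PGF-modules have shorter resolutions. -/
theorem HasResolution.of_syzygy {n : ℕ} (h : SES K G M) (hG : IsPGF G)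
    (hM : HasResolution (n + 1) M) : HasResolution n K := by
  obtain ⟨L, G', hS, hG', hL⟩ := hasResolution_succ_iff.1 hM
  -- Schanuel's argument: the pullback is an extension of `G` by `L` and also of `G'` by `K`.
  obtain ⟨Z, hLZ, hKZ⟩ := hS.pullback h
  exact HasResolution.of_kernel hKZ (HasResolution.of_extension hLZ hL hG) hG'

/-- A module that is the quotient of a module with a resolution of length `n + 1` by a PGF-module
has such a resolution, too. -/
theorem HasResolution.of_quotient {n : ℕ} (h : SES G N K) (hG : IsPGF G)
    (hN : HasResolution (n + 1) N) : HasResolution (n + 1) K := by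
  obtain ⟨L, G', hS, hG', hL⟩ := hasResolution_succ_iff.1 hN
  obtain ⟨W, hWG, hLW⟩ := hS.comp_epi h
  exact hasResolution_succ_iff.2 ⟨W, G', hWG, hG', HasResolution.of_extension hLW hL hG⟩

theorem HasResolution.of_pgf_extension {n : ℕ} (h : SES G N K) (hG : IsPGF G)
    (hK : HasProjectiveDimensionLE K n) : HasResolution n N := by
  cases n with
  | zero =>
    exact hasResolution_zero_iff.2 (IsPGF.of_extension h hG
      (isPGF_of_projective ((projective_iff_hasProjectiveDimensionLE_zero _).2 hK)))
  | succ n =>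
    obtain ⟨L, P, hP, hS⟩ := exists_projective_presentation K
    obtain ⟨Z, hLZ, hGZ⟩ := hS.pullback h
    exact hasResolution_succ_iff.2 ⟨L, Z, hLZ,
      IsPGF.of_extension hGZ hG (isPGF_of_projective hP),
      hasResolution_of_hasProjectiveDimensionLE (hS.hasProjectiveDimensionLE_kernel hP hK)⟩

theorem SES.biprod (M P : ModuleCat.{u} R) : SES M (M ⊞ P) P :=
  ⟨biprod.inl, biprod.snd, biprod.inl_snd,
    (ShortComplex.Splitting.ofHasBinaryBiproduct M P).shortExact⟩

theorem hasResolution_biprod_iff {n : ℕ} (hP : IsPGF P) :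
    HasResolution n (M ⊞ P) ↔ HasResolution n M :=
  ⟨fun h => HasResolution.of_kernel (SES.biprod M P) h hP,
    fun h => HasResolution.of_extension (SES.biprod M P) h hP⟩

theorem inRightOrthogonal_of_projective (hP : Projective P) : InRightOrthogonal P :=
  fun _ hG => hG.ext_subsingleton (Or.inl hP) 0

theorem homExact_of_surjective {f : A ⟶ B} {g : B ⟶ C} {w : f ≫ g = 0}
    (h : (ShortComplex.mk f g w).ShortExact) {Q : ModuleCat.{u} R}
    (hs : ∀ k : A ⟶ Q, ∃ l : B ⟶ Q, f ≫ l = k) : HomExact f g Q := by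
  have : Epi g := h.epi_g
  refine ⟨fun a b hab => (cancel_epi g).1 hab, fun k => ⟨fun hk => ?_, ?_⟩, hs⟩
  · exact ⟨h.exact.desc k hk, h.exact.g_desc k hk⟩
  · rintro ⟨l, rfl⟩
    change f ≫ g ≫ l = 0
    rw [reassoc_of% w, zero_comp]

end Dimensions

/-! ### The individual implications -/

section Characterizations

variable {R : Type u} [Ring R] {G K M P : ModuleCat.{u} R} {n : ℕ}

theorem exists_precover_of_dim_eq (h : dim M = n) :
    ∃ (K G : ModuleCat.{u} R) (f : K ⟶ G) (g : G ⟶ M) (w : f ≫ g = 0),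
      (ShortComplex.mk f g w).ShortExact ∧ IsPGF G ∧ (n = 0 → IsZero K) ∧
      (∀ m : ℕ, n = m + 1 → pd K = (m : ℕ∞)) ∧
      (n = 1 → ¬ Nonempty (ShortComplex.mk f g w).Splitting) := by
  obtain ⟨hr, hlt⟩ := dim_eq_iff.1 h
  cases n with
  | zero =>
    have hz : IsZero (ModuleCat.of R PUnit) := ModuleCat.isZero_of_subsingleton _
    have hM := hasResolution_zero_iff.1 hr
    refine ⟨ModuleCat.of R PUnit, M, 0, 𝟙 M, by simp,
      { exact := (ShortComplex.exact_iff_mono _ rfl).2 (by dsimp; infer_instance)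
        mono_f := ⟨fun _ _ _ => hz.eq_of_tgt _ _⟩
        epi_g := by dsimp; infer_instance }, hM, fun _ => hz, by simp, by simp⟩
  | succ n =>
    obtain ⟨K, G, ⟨f, g, w, hS⟩, hK, hG⟩ := hr.exists_precover
    refine ⟨K, G, f, g, w, hS, hG, by simp, ?_, ?_⟩
    · intro m hm
      obtain rfl : n = m := by lia
      refine pd_eq hK fun k hk hKk => hlt (k + 1) (by lia) ?_
      exact hasResolution_succ_iff.2
        ⟨K, G, ⟨f, g, w, hS⟩, hG, hasResolution_of_hasProjectiveDimensionLE hKk⟩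
    · rintro hn ⟨σ⟩
      obtain rfl : n = 0 := by lia
      -- Here `K` is projective, and reversing a splitting would exhibit `M` as the kernel of an
      -- epimorphism from `G` to `K`, hence as PGF.
      refine hlt 0 (by lia) (hasResolution_zero_iff.2 (IsPGF.of_kernel (B := G) (C := K) ?_ hG
        (isPGF_of_projective ((projective_iff_hasProjectiveDimensionLE_zero _).2 hK))))
      let τ : (ShortComplex.mk σ.s σ.r σ.s_r).Splitting :=
        { r := g, s := f, f_r := σ.s_g, s_g := σ.f_r, id := by rw [add_comm]; exact σ.id }
      exact ⟨σ.s, σ.r, σ.s_r, τ.shortExact⟩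

theorem dim_eq_of_precover {f : K ⟶ G} {g : G ⟶ M} {w : f ≫ g = 0}
    (hS : (ShortComplex.mk f g w).ShortExact) (hG : IsPGF G) (hz : n = 0 → IsZero K)
    (hpd : ∀ m : ℕ, n = m + 1 → pd K = (m : ℕ∞))
    (hns : n = 1 → ¬ Nonempty (ShortComplex.mk f g w).Splitting) : dim M = n := by
  rw [dim_eq_iff]
  cases n with
  | zero =>
    have : IsIso g := hS.isIso_g_iff.2 (hz rfl)
    exact ⟨⟨G, hG, ⟨asIso g⟩⟩, by simp⟩
  | succ n =>
    have hK := hpd n rfl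
    have hK' := hasProjectiveDimensionLE_of_pd_eq hK
    have hSES : SES K G M := ⟨f, g, w, hS⟩
    refine ⟨hasResolution_succ_iff.2
      ⟨K, G, hSES, hG, hasResolution_of_hasProjectiveDimensionLE hK'⟩, fun k hk hr => ?_⟩
    cases k with
    | zero =>
      have hM := hasResolution_zero_iff.1 hr
      -- If `M` were PGF, then so would be `K`; having finite projective dimension, `K` would be
      -- projective. Only `n + 1 = 1` remains, where the sequence would split.
      have hK0 := (hasResolution_zero_iff.2
        (IsPGF.of_kernel hSES hG hM)).hasProjectiveDimensionLE hK'
      obtain rfl : n = 0 := Nat.le_zero.1 (le_of_pd_eq hK hK0)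
      obtain ⟨r, hr⟩ := exists_extension_of_ext_one hS
        (hM.ext_subsingleton_of_hasProjectiveDimensionLE hK' 0) (𝟙 K)
      have := hS.epi_g
      exact hns rfl ⟨ShortComplex.Splitting.ofExactOfRetraction _ hS.exact r hr hS.epi_g⟩
    | succ k =>
      have := le_of_pd_eq hK ((HasResolution.of_syzygy hSES hG hr).hasProjectiveDimensionLE hK')
      lia

theorem exists_embedding_of_dim_eq (h : dim M = n) :
    ∃ (K G : ModuleCat.{u} R) (f : M ⟶ K) (g : K ⟶ G) (w : f ≫ g = 0),
      (ShortComplex.mk f g w).ShortExact ∧ IsPGF G ∧ pd K = (n : ℕ∞) := by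
  obtain ⟨hr, hlt⟩ := dim_eq_iff.1 h
  obtain ⟨K, G, hS, hK, hG⟩ := hr.exists_embedding
  refine (fun ⟨f, g, w, h⟩ => ⟨K, G, f, g, w, h, hG, pd_eq hK fun k hk hKk => ?_⟩) hS
  exact hlt k hk (HasResolution.of_kernel hS (hasResolution_of_hasProjectiveDimensionLE hKk) hG)

theorem dim_eq_of_embedding (hS : SES M K G) (hG : IsPGF G) (hK : pd K = n) : dim M = n := by
  have hK' := hasProjectiveDimensionLE_of_pd_eq hK
  refine dim_eq_iff.2 ⟨HasResolution.of_kernel hS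
    (hasResolution_of_hasProjectiveDimensionLE hK') hG, fun k hk hr => ?_⟩
  have := le_of_pd_eq hK ((HasResolution.of_extension hS hr hG).hasProjectiveDimensionLE hK')
  lia

/-- Lifting a projective presentation `P ⟶ G` to `K` gives an epimorphism `M ⊞ P ⟶ K` whose kernel
is the syzygy `N` of `G`. The projection to `P` recovers the inclusion `N ⟶ P`, so maps from `N` to
`Q` extend because `Ext¹` from `G` to `Q` vanishes. -/
theorem exists_relative_sequence_of_embedding {f : M ⟶ K} {g : K ⟶ G} {w : f ≫ g = 0}
    (hS : (ShortComplex.mk f g w).ShortExact) (hG : IsPGF G) :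
    ∃ P : ModuleCat.{u} R, Projective P ∧
      ∃ (N : ModuleCat.{u} R) (i : N ⟶ M ⊞ P) (p : M ⊞ P ⟶ K) (w : i ≫ p = 0),
        (ShortComplex.mk i p w).ShortExact ∧
        (∀ Q : ModuleCat.{u} R, InRightOrthogonal Q → HomExact i p Q) ∧ IsPGF N := by
  obtain ⟨N, P, hP, hN⟩ := exists_projective_presentation G
  have hNG := IsPGF.of_kernel hN (isPGF_of_projective hP) hG
  obtain ⟨κ, π, wκ, hκ⟩ := hN
  have hmκ : Mono κ := hκ.mono_f
  have heπ : Epi π := hκ.epi_g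
  have hmf : Mono f := hS.mono_f
  have heg : Epi g := hS.epi_g
  let l : P ⟶ K := Projective.factorThru π g
  have hl : l ≫ g = π := Projective.factorThru_comp π g
  have hκl : (κ ≫ l) ≫ g = 0 := by rw [Category.assoc, hl, wκ]
  let t : N ⟶ M := hS.exact.lift (κ ≫ l) hκl
  have ht : t ≫ f = κ ≫ l := hS.exact.lift_f _ _
  let i : N ⟶ M ⊞ P := biprod.lift (-t) κ
  have hi : i ≫ biprod.snd = κ := biprod.lift_snd _ _
  have hmi : Mono i := by
    have : Mono (i ≫ biprod.snd) := by rwa [hi]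
    exact mono_of_mono i biprod.snd
  have wi : i ≫ biprod.desc f l = 0 := by simp [i, ht]
  have hdesc : Epi (biprod.desc f l) := by
    refine Preadditive.epi_of_cancel_zero _ fun {T} x hx => ?_
    have h1 : f ≫ x = 0 := by simpa using biprod.inl ≫= hx
    have h2 : l ≫ x = 0 := by simpa using biprod.inr ≫= hx
    obtain ⟨y, rfl⟩ : ∃ y, g ≫ y = x := ⟨hS.exact.desc x h1, hS.exact.g_desc x h1⟩
    rw [← Category.assoc, hl, ← comp_zero (f := π), cancel_epi] at h2
    rw [h2, comp_zero]
  have hse : (ShortComplex.mk i (biprod.desc f l) wi).ShortExact :=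
    { exact := by
        refine ShortComplex.exact_of_f_is_kernel _ (KernelFork.IsLimit.ofι' i wi
          fun {T} x hx => ?_)
        have hx' : (x ≫ biprod.fst) ≫ f + (x ≫ biprod.snd) ≫ l = 0 := by
          rw [biprod.desc_eq, Preadditive.comp_add] at hx
          simpa using hx
        have hx2 : (x ≫ biprod.snd) ≫ π = 0 := by
          have := hx' =≫ g
          simpa [w, hl] using this
        refine ⟨hκ.exact.lift (x ≫ biprod.snd) hx2, ?_⟩
        have hs : hκ.exact.lift (x ≫ biprod.snd) hx2 ≫ κ = x ≫ biprod.snd :=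
          hκ.exact.lift_f _ _
        refine biprod.hom_ext _ _ ?_ ?_
        · rw [← cancel_mono f]
          simp only [i, Category.assoc, biprod.lift_fst_assoc, Preadditive.neg_comp,
            Preadditive.comp_neg, ht]
          rw [← Category.assoc, hs, ← Category.assoc]
          exact (eq_neg_of_add_eq_zero_left hx').symm
        · rw [Category.assoc, hi, hs]
      mono_f := hmi
      epi_g := hdesc }
  refine ⟨P, hP, N, i, biprod.desc f l, wi, hse, fun Q hQ => homExact_of_surjective hse
    fun k => ?_, hNG⟩
  obtain ⟨v, hv⟩ := exists_extension_of_ext_one hκ (hQ G hG) k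
  exact ⟨biprod.snd ≫ v, by rw [← Category.assoc, hi]; exact hv⟩

theorem dim_eq_of_relative_sequence (hP : IsPGF P) {i : G ⟶ M ⊞ P} {p : M ⊞ P ⟶ K} {w : i ≫ p = 0}
    (hS : (ShortComplex.mk i p w).ShortExact) (hG : IsPGF G) (hK : pd K = n)
    (hQ : n = 1 → ∀ Q : ModuleCat.{u} R, Projective Q → HomExact i p Q) : dim M = n := by
  have hK' := hasProjectiveDimensionLE_of_pd_eq hK
  have hSES : SES G (M ⊞ P) K := ⟨i, p, w, hS⟩
  refine dim_eq_iff.2 ⟨(hasResolution_biprod_iff hP).1 (HasResolution.of_pgf_extension hSES hG hK'),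
    fun k hk hr => ?_⟩
  rw [← hasResolution_biprod_iff hP] at hr
  cases k with
  | succ k =>
    have := le_of_pd_eq hK ((HasResolution.of_quotient hSES hG hr).hasProjectiveDimensionLE hK')
    lia
  | zero =>
    have hN := hasResolution_zero_iff.1 hr
    -- If `M ⊞ P` is PGF, the given sequence is itself a PGF-resolution of `K` of length one, which
    -- forces `n = 1`.
    have h1 : HasResolution 1 K :=
      hasResolution_succ_iff.2 ⟨G, _, hSES, hN, hasResolution_zero_iff.2 hG⟩
    have := le_of_pd_eq hK (h1.hasProjectiveDimensionLE hK')
    obtain rfl : n = 1 := by lia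
    obtain ⟨L, F, hF, hL⟩ := exists_projective_presentation K
    have hLp : Projective L := (projective_iff_hasProjectiveDimensionLE_zero _).2
      (hL.hasProjectiveDimensionLE_kernel hF hK')
    -- Exactness of `Hom` into the projective syzygy `L` of `K` makes the presentation of `K` split.
    -- Then `K` is projective, contradicting `pd K = 1`.
    have hext : Subsingleton (Abelian.Ext K L 1) := ext_one_subsingleton_of_extension hS
      (hN.ext_subsingleton (Or.inl hLp) 0) (hQ rfl L hLp).2.2
    obtain ⟨e⟩ := hL.iso_prod hext
    have : HasProjectiveDimensionLT F 1 := (projective_iff_hasProjectiveDimensionLE_zero _).1 hF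
    have hK0 : HasProjectiveDimensionLE K 0 :=
      Retract.hasProjectiveDimensionLT (Y := F)
        { i := ModuleCat.ofHom (LinearMap.inr R L K) ≫ e.inv
          r := e.hom ≫ ModuleCat.ofHom (LinearMap.snd R L K)
          retract := by simp; rfl } 1
    have := le_of_pd_eq hK hK0
    lia

end Characterizations

end PGF

theorem theorem3p4 {R : Type u} [Ring R] (M : ModuleCat.{u} R) (n : ℕ) :
    List.TFAE [
      PGF.dim M = (n : ℕ∞),
      ∃ (K G : ModuleCat.{u} R) (f : K ⟶ G) (g : G ⟶ M) (w : f ≫ g = 0),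
        (ShortComplex.mk f g w).ShortExact ∧ PGF.IsPGF G ∧
        (n = 0 → IsZero K) ∧
        (∀ m : ℕ, n = m + 1 → PGF.pd K = (m : ℕ∞)) ∧
        (n = 1 → ¬ Nonempty (ShortComplex.mk f g w).Splitting),
      ∃ (K G : ModuleCat.{u} R) (f : M ⟶ K) (g : K ⟶ G) (w : f ≫ g = 0),
        (ShortComplex.mk f g w).ShortExact ∧ PGF.IsPGF G ∧ PGF.pd K = (n : ℕ∞),
      ∃ P : ModuleCat.{u} R, Projective P ∧
        ∃ (G K : ModuleCat.{u} R) (f : G ⟶ M ⊞ P) (g : M ⊞ P ⟶ K) (w : f ≫ g = 0),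
          (ShortComplex.mk f g w).ShortExact ∧
          (∀ Q : ModuleCat.{u} R, PGF.InRightOrthogonal Q → PGF.HomExact f g Q) ∧
          PGF.IsPGF G ∧ PGF.pd K = (n : ℕ∞),
      ∃ P : ModuleCat.{u} R, PGF.IsPGF P ∧
        ∃ (G K : ModuleCat.{u} R) (f : G ⟶ M ⊞ P) (g : M ⊞ P ⟶ K) (w : f ≫ g = 0),
          (ShortComplex.mk f g w).ShortExact ∧ PGF.IsPGF G ∧ PGF.pd K = (n : ℕ∞) ∧
          (n = 1 → ∀ Q : ModuleCat.{u} R, Projective Q → PGF.HomExact f g Q)] := by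
  tfae_have 1 → 2 := PGF.exists_precover_of_dim_eq
  tfae_have 2 → 1 := by
    rintro ⟨K, G, f, g, w, hS, hG, hz, hpd, hns⟩
    exact PGF.dim_eq_of_precover hS hG hz hpd hns
  tfae_have 1 → 3 := PGF.exists_embedding_of_dim_eq
  tfae_have 3 → 1 := by
    rintro ⟨K, G, f, g, w, hS, hG, hK⟩
    exact PGF.dim_eq_of_embedding ⟨f, g, w, hS⟩ hG hK
  tfae_have 3 → 4 := by
    rintro ⟨K, G, f, g, w, hS, hG, hK⟩
    obtain ⟨P, hP, N, i, p, w', hS', hQ, hN⟩ := PGF.exists_relative_sequence_of_embedding hS hG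
    exact ⟨P, hP, N, K, i, p, w', hS', hQ, hN, hK⟩
  tfae_have 4 → 5 := by
    rintro ⟨P, hP, G, K, f, g, w, hS, hQ, hG, hK⟩
    exact ⟨P, PGF.isPGF_of_projective hP, G, K, f, g, w, hS, hG, hK,
      fun _ Q hPQ => hQ Q (PGF.inRightOrthogonal_of_projective hPQ)⟩
  tfae_have 5 → 1 := by
    rintro ⟨P, hP, G, K, f, g, w, hS, hG, hK, hQ⟩
    exact PGF.dim_eq_of_relative_sequence hP hS hG hK hQ
  tfae_finish
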